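/- **Trees.** A rooted tree is a partially ordered set $(T,\preceq)$ with a minimum $\emptyset$ (the root) such that for every $\tau\in T$ the set $\{\tau'\in T\mid\tau'\preceq\tau\}$ is order isomorphic to $\{0,\dots,n\}$ for some $n\ge 0$; this $n$ is the height $|\tau|$. Put $I_\tau=\{\omega\in T\mid \omega\succ\tau,\ |\omega|=|\tau|+1\}$, and let $T$ be pruned and finitely splitting: $1\le\#I_\tau<\infty$ for all $\tau\in T$. For $n\le|\tau|$, $\tau|_n$ is the vertex with $\tau|_n\preceq\tau$ and height $n$. $\partial T$ is the set of infinite simple paths $(\omega_0=\emptyset,\omega_1,\omega_2,\dots)$ starting from the root, so that $\omega_{n+1}\in I_{\omega_n}$ for all $n$. **Conformal TIFS.** Let $X\subset\mathbb R^d$ be compact, connected and non-empty. A conformal tree iterated function system $\Psi=\{\phi_\tau\}_{\tau\in T\setminus\{\emptyset\}}$ on $X$ is a family of maps $\phi_\tau:X\to X$ for which there is $s\in(0,1)$ with $\|\phi_\tau(x)-\phi_\tau(y)\|\le s\|x-y\|$ for all $\tau\neq\emptyset$ and $x,y\in X$, and which satisfies the following. Write $\Phi_\tau=\phi_{\tau|_1}\circ\cdots\circ\phi_{\tau|_{|\tau|}}$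 and $\Phi_\emptyset=\mathrm{Id}$. 1. (Conformality) There is an open set $V$ with $X\subset V\subset\mathbb R^d$ such that every $\phi_\tau$, $\tau\neq\emptyset$, extends to a conformal $C^1$ diffeomorphism of $V$ onto its image, with image contained in $V$ (the extension is again denoted by $\phi_\tau$; conformal means that the derivative at each point is a non-zero multiple of a linear isometry). 2. (Open set condition) $\phi_\omega(\operatorname{int}X)\cap\phi_\rho(\operatorname{int}X)=\emptyset$ for all $\tau\in T$ and all $\omega\ne\rho$ in $I_\tau$. 3. (Cone condition) There are $0<\alpha<\pi$ and $l>0$ such that for every $x\in\partial X$ there is a unit vector $v$ with $\{y\in\mathbb R^d\mid 0<\|y-x\|<l,\ (y-x,v)>\|y-x\|\cos\alpha\}\subset\operatorname{int}X$. 4. (Bounded distortion) There is $K\ge1$ with $|\Phi_\tau'(x)|\le K|\Phi_\tau'(y)|$ for all $\tau\in T$ and $x,y\in V$, where $|\cdot|$ is the operator norm of the derivative. The limit set $J$ is the set of all points $x$ with $\{x\}=\bigcap_{n\ge1}\Phi_{\omega_n}(X)$ for some $\omega\in\partial T$. Let $\|\Phi_\omega'\|=\sup_{x\in X}|\Phi_\omega'(x)|$.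 For $t\ge0$ and $n\ge1$ let $$Z_n^*(t)=\min_A\sum_{\omega\in A}\|\Phi_\omega'\|^t,$$ where $A$ ranges over all maximal antichains in $\{\tau\in T\mid 0<|\tau|\le n\}$, and let $Z_\infty^*(t)=\lim_{n\to\infty}Z_n^*(t)$ and $\beta^*(\Psi)=\inf\{t\ge0\mid Z_\infty^*(t)=0\}$ (with $\inf\varnothing=\infty$). **Theorem.** Let $\Psi$ be a conformal TIFS with limit set $J$. For every $t\ge0$ the limit $Z_\infty^*(t)$ exists, and: (i) If $Z_\infty^*(t)=0$, then $\dim_H(J)\le t$. (ii) Assume in addition that $\displaystyle\lim_{|\tau|\to\infty}\frac1{|\tau|}\log\#I_\tau=0$. If $Z_\infty^*(t)>0$, then $\dim_H(J)\ge t$. In particular, under the growth condition in (ii), $\dim_H(J)=\beta^*(\Psi)$. -/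

import Mathlib

open Filter Topology

namespace TreeIFS

/-! ### Rooted trees -/

section Tree

/-- A partially ordered set with a minimum `⊥` (the root) is a rooted tree if, for every vertex
`τ`, the set of vertices below `τ` is order isomorphic to `{0, …, n}` for some `n`. -/
def IsRootedTree (T : Type*) [PartialOrder T] [OrderBot T] : Prop :=
  ∀ τ : T, ∃ n : ℕ, Nonempty (Set.Iic τ ≃o Fin (n + 1))

/-- The height `|τ|`: the number of vertices strictly below `τ`
(see `height_eq` for the characterization through `{0, …, n}`). -/
noncomputable def height {T : Type*} [PartialOrder T] (τ : T) : ℕ :=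
  (Set.Iio τ).ncard

/-- `height τ` is the number `n` with `{τ' | τ' ≤ τ} ≃o {0, …, n}`. -/
theorem height_eq {T : Type*} [PartialOrder T] (τ : T) (n : ℕ)
    (h : Nonempty (Set.Iic τ ≃o Fin (n + 1))) : height τ = n := by
  obtain ⟨e⟩ := h
  have h1 : (Set.Iic τ).ncard = n + 1 := by
    rw [← Nat.card_coe_set_eq, Nat.card_congr e.toEquiv, Nat.card_fin]
  have hfin : (Set.Iic τ).Finite := Set.finite_of_ncard_ne_zero (by omega)
  have h2 : Set.Iio τ = Set.Iic τ \ {τ} := (Set.Iic_sdiff_right).symm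
  unfold height
  rw [h2, Set.ncard_sdiff_singleton_of_mem Set.self_mem_Iic, h1]
  rfl

/-- `I_τ`: the set of successors of the vertex `τ`. -/
def successors {T : Type*} [PartialOrder T] (τ : T) : Set T :=
  {ω | τ < ω ∧ height ω = height τ + 1}

/-- The tree is pruned and finitely splitting: every vertex has a nonzero finite number of
successors. -/
def IsPrunedFinitelySplitting (T : Type*) [PartialOrder T] : Prop :=
  ∀ τ : T, (successors τ).Nonempty ∧ (successors τ).Finite

open Classical in
/-- `τ|_n`: the unique vertex below `τ` of height `n`, for `n ≤ |τ|` (and `τ` itself for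
other `n`, a value which is never used). -/
noncomputable def trunc {T : Type*} [PartialOrder T] (τ : T) (n : ℕ) : T :=
  if h : ∃ σ : T, σ ≤ τ ∧ height σ = n then h.choose else τ

/-- `∂T`: the infinite simple paths `ω 0 = ⊥, ω 1, ω 2, …` starting from the root. -/
def boundary (T : Type*) [PartialOrder T] [OrderBot T] : Set (ℕ → T) :=
  {ω | ω 0 = ⊥ ∧ ∀ n, ω (n + 1) ∈ successors (ω n)}

/-- `{τ ∈ T | 0 < |τ| ≤ n}`: the vertices of height at most `n` strictly above the root. -/
def belowLevel (T : Type*) [PartialOrder T] [OrderBot T] (n : ℕ) : Set T :=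
  {τ | ⊥ < τ ∧ height τ ≤ n}

/-- `A` is a maximal antichain in the subset `P`: among all antichains contained in `P`,
it is maximal for inclusion. -/
def IsMaximalAntichainIn {T : Type*} [PartialOrder T] (P A : Set T) : Prop :=
  Maximal (fun B : Set T => B ⊆ P ∧ IsAntichain (· ≤ ·) B) A

/-- The growth condition `(1 / |τ|) log #I_τ → 0` as `|τ| → ∞`. -/
def SubexponentialSplitting (T : Type*) [PartialOrder T] : Prop :=
  Tendsto (fun τ : T => (1 / (height τ : ℝ)) * Real.log ((successors τ).ncard : ℝ))
    (comap height atTop) (𝓝 0)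

end Tree

/-! ### Tree iterated function systems

The maps `φ τ` (`τ ≠ ⊥`) are given as functions on an ambient space; only their restrictions to
`X` (and, for conformal systems, to an open neighbourhood `V` of `X`) matter. The value `φ ⊥` is
never used. -/

section System

/-- `{φ_τ : X → X}`, `τ ∈ T \ {⊥}`, is a tree iterated function system on the compact connected
metric space `X`: the maps are uniformly contracting. -/
structure IsTIFS {T : Type*} [PartialOrder T] [OrderBot T] {M : Type*} [MetricSpace M]
    (X : Set M) (φ : T → M → M) : Prop where
  isCompact : IsCompact X
  isConnected : IsConnected X
  mapsTo : ∀ τ : T, τ ≠ ⊥ → Set.MapsTo (φ τ) X X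
  contracting : ∃ s : ℝ, 0 < s ∧ s < 1 ∧ ∀ τ : T, τ ≠ ⊥ → ∀ x ∈ X, ∀ y ∈ X,
    dist (φ τ x) (φ τ y) ≤ s * dist x y

/-- `φ_{τ|_1} ∘ ⋯ ∘ φ_{τ|_k}`. -/
noncomputable def partialComp {T : Type*} [PartialOrder T] {M : Type*} (φ : T → M → M) (τ : T) :
    ℕ → M → M
  | 0 => id
  | k + 1 => partialComp φ τ k ∘ φ (trunc τ (k + 1))

/-- `Φ_τ = φ_{τ|_1} ∘ ⋯ ∘ φ_{τ|_n}` with `n = |τ|`; the identity for the root. -/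
noncomputable def Phi {T : Type*} [PartialOrder T] {M : Type*} (φ : T → M → M) (τ : T) : M → M :=
  partialComp φ τ (height τ)

/-- The limit set `J = π(∂T)`, where `π ω` is the point with
`⋂_{n ≥ 1} Φ_{ω|_n}(X) = {π ω}`. -/
def limitSet {T : Type*} [PartialOrder T] [OrderBot T] {M : Type*}
    (X : Set M) (φ : T → M → M) : Set M :=
  {x | ∃ ω ∈ boundary T, ⋂ n ∈ Set.Ici 1, Phi φ (ω n) '' X = {x}}

/-- The open cone with vertex `x`, angle `α`, altitude `l` and direction `v`. -/
def openCone {d : ℕ} (x : EuclideanSpace ℝ (Fin d)) (α l : ℝ) (v : EuclideanSpace ℝ (Fin d)) :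
    Set (EuclideanSpace ℝ (Fin d)) :=
  {y | 0 < ‖y - x‖ ∧ ‖y - x‖ < l ∧ ‖y - x‖ * Real.cos α < inner ℝ (y - x) v}

/-- Conformal tree iterated function systems on `X ⊆ ℝ^d`. -/
structure IsConformalTIFS {T : Type*} [PartialOrder T] [OrderBot T] {d : ℕ}
    (X : Set (EuclideanSpace ℝ (Fin d)))
    (φ : T → EuclideanSpace ℝ (Fin d) → EuclideanSpace ℝ (Fin d)) : Prop extends
    IsTIFS X φ where
  /-- Conformality and bounded distortion: on some open `V ⊇ X`, each `φ_τ` (`τ ≠ ⊥`) maps `V`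
  into itself and is a conformal `C^1` diffeomorphism of `V` onto its image (injective, `C^1`, with
  derivative a nonzero multiple of a linear isometry at each point, so that the inverse is `C^1` by
  the inverse function theorem), and the derivatives of all `Φ_τ` on `V` have distortion bounded
  by one constant `K`. -/
  conformal_distortion : ∃ V : Set (EuclideanSpace ℝ (Fin d)), IsOpen V ∧ X ⊆ V ∧
    (∀ τ : T, τ ≠ ⊥ → Set.MapsTo (φ τ) V V ∧ Set.InjOn (φ τ) V ∧ ContDiffOn ℝ 1 (φ τ) V ∧
      ∀ x ∈ V, ConformalAt (φ τ) x) ∧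
    ∃ K : ℝ, 1 ≤ K ∧ ∀ τ : T, ∀ x ∈ V, ∀ y ∈ V,
      ‖fderiv ℝ (Phi φ τ) x‖ ≤ K * ‖fderiv ℝ (Phi φ τ) y‖
  /-- Open set condition. -/
  open_set_condition : ∀ τ : T, ∀ ω ∈ successors τ, ∀ ρ ∈ successors τ, ω ≠ ρ →
    Disjoint (φ ω '' interior X) (φ ρ '' interior X)
  /-- Cone condition. -/
  cone_condition : ∃ α l : ℝ, 0 < α ∧ α < Real.pi ∧ 0 < l ∧ ∀ x ∈ frontier X,
    ∃ v : EuclideanSpace ℝ (Fin d), ‖v‖ = 1 ∧ openCone x α l v ⊆ interior X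

/-- `‖Φ_ω'‖ = sup_{x ∈ X} |Φ_ω'(x)|`, with the operator norm of the derivative. -/
noncomputable def derivNorm {T : Type*} [PartialOrder T] {d : ℕ}
    (X : Set (EuclideanSpace ℝ (Fin d)))
    (φ : T → EuclideanSpace ℝ (Fin d) → EuclideanSpace ℝ (Fin d)) (ω : T) : ℝ :=
  ⨆ x : X, ‖fderiv ℝ (Phi φ ω) (x : EuclideanSpace ℝ (Fin d))‖

/-- `Z_n^*(t)` for `n ≥ 1`: the minimum of `∑_{ω ∈ A} ‖Φ_ω'‖^t` over the maximal antichains `A`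
in `{τ ∈ T | 0 < |τ| ≤ n}`. This is a finite set when the tree is finitely splitting, so the
antichains are `Finset`s and the infimum is a minimum. -/
noncomputable def Zstar {T : Type*} [PartialOrder T] [OrderBot T] {d : ℕ}
    (X : Set (EuclideanSpace ℝ (Fin d)))
    (φ : T → EuclideanSpace ℝ (Fin d) → EuclideanSpace ℝ (Fin d)) (t : ℝ) (n : ℕ) : ℝ :=
  sInf {z : ℝ | ∃ A : Finset T, IsMaximalAntichainIn (belowLevel T n) (A : Set T) ∧
    z = ∑ ω ∈ A, derivNorm X φ ω ^ t}

/-- `Z_∞^*(t) = lim_{n → ∞} Z_n^*(t)`. -/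
noncomputable def ZstarInf {T : Type*} [PartialOrder T] [OrderBot T] {d : ℕ}
    (X : Set (EuclideanSpace ℝ (Fin d)))
    (φ : T → EuclideanSpace ℝ (Fin d) → EuclideanSpace ℝ (Fin d)) (t : ℝ) : ℝ :=
  limUnder atTop (Zstar X φ t)

/-- `β^* = inf {t ≥ 0 | Z_∞^*(t) = 0}`, as an element of `[0, ∞]`. -/
noncomputable def betaStar {T : Type*} [PartialOrder T] [OrderBot T] {d : ℕ}
    (X : Set (EuclideanSpace ℝ (Fin d)))
    (φ : T → EuclideanSpace ℝ (Fin d) → EuclideanSpace ℝ (Fin d)) : ENNReal :=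
  sInf {b : ENNReal | ∃ t : ℝ, 0 ≤ t ∧ ZstarInf X φ t = 0 ∧ b = ENNReal.ofReal t}

end System

end TreeIFS

/-! Upper bound. Every maximal antichain `A` yields a finite cover of the limit set by the pieces
`Φ_a(X)`. Bounded distortion, together with connectedness and compactness of `X`, bounds their
diameters by a constant times `‖Φ_a'‖` (`exists_dist_Phi_le`). If `Z_∞^*(t) = 0` with `t > 0`, the
sums of `‖Φ_a'‖^t` can be made arbitrarily small. Every single diameter is then small too, so these
covers show that the `t`-dimensional Hausdorff measure vanishes.

Lower bound. Suppose `Z_∞^*(t) > 0` while the `s`-dimensional measure of `J` vanishes for some `0 <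
s < t`. Cover `J` by countably many balls of radii `r_i ≤ 1` with `∑ r_i^s ≤ ε`. Along an infinite
path the norms `‖Φ'‖` go from `1` to `0`. Hence a path whose limit point lies in the `i`-th ball has
an edge `p → c` at which the norm passes the value `r_i`. The vertices `c` so obtained meet every
path, so by König's lemma (`exists_height_forall_exists_le`) they already cut the tree at a finite
level, and their minimal elements there form a maximal antichain.

It remains to bound the contribution of one ball by `C r^s` (`exists_sum_le`). Among the
predecessors `p` of a given height `n`, the number is bounded by a constant: the open set condition
makes the pieces disjoint inside, and the cone condition gives each a volume of order `r^d` near the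
ball (`exists_card_le`). Each `p` has at most `B e^{ηn}` successors, whose norms are at most `r`,
and `r ≤ K σ^n` gives `r^t ≤ r^s (K σ^n)^{t-s}`. For small `η` the sum over `n` is dominated by a
geometric series. Thus `Z_∞^*(t) ≤ C ε` for every `ε`, a contradiction. -/

namespace TreeIFS

/-! ### Rooted trees: heights, cut sets and maximal antichains. -/

section Tree

variable {T : Type*} [PartialOrder T] [OrderBot T]

theorem IsRootedTree.finite_Iic (hT : IsRootedTree T) (τ : T) : (Set.Iic τ).Finite := by
  obtain ⟨n, ⟨e⟩⟩ := hT τ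
  exact Set.finite_coe_iff.mp (Finite.of_equiv _ e.symm.toEquiv)

theorem IsRootedTree.total_of_le (hT : IsRootedTree T) {a b τ : T} (ha : a ≤ τ) (hb : b ≤ τ) :
    a ≤ b ∨ b ≤ a := by
  obtain ⟨n, ⟨e⟩⟩ := hT τ
  rcases le_total (e ⟨a, ha⟩) (e ⟨b, hb⟩) with h | h
  · exact Or.inl (e.le_iff_le.mp h)
  · exact Or.inr (e.le_iff_le.mp h)

theorem IsRootedTree.height_lt (hT : IsRootedTree T) {a b : T} (h : a < b) :
    height a < height b := by
  refine Set.ncard_lt_ncard ?_ ((hT.finite_Iic b).subset Set.Iio_subset_Iic_self)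
  exact Set.Iio_ssubset_Iio h

theorem IsRootedTree.height_le (hT : IsRootedTree T) {a b : T} (h : a ≤ b) :
    height a ≤ height b := by
  rcases h.eq_or_lt with rfl | h
  · exact le_rfl
  · exact (hT.height_lt h).le

theorem IsRootedTree.eq_of_le_of_height_eq (hT : IsRootedTree T) {a b τ : T} (ha : a ≤ τ)
    (hb : b ≤ τ) (h : height a = height b) : a = b := by
  rcases hT.total_of_le ha hb with h' | h'
  · rcases h'.eq_or_lt with h'' | h''
    · exact h''
    · exact absurd h (hT.height_lt h'').ne
  · rcases h'.eq_or_lt with h'' | h''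
    · exact h''.symm
    · exact absurd h (hT.height_lt h'').ne'

theorem IsRootedTree.le_of_height_le (hT : IsRootedTree T) {a b τ : T} (ha : a ≤ τ)
    (hb : b ≤ τ) (h : height a ≤ height b) : a ≤ b := by
  rcases hT.total_of_le ha hb with h' | h'
  · exact h'
  · exact (hT.eq_of_le_of_height_eq ha hb (le_antisymm h (hT.height_le h'))).le

/-- The height is injective on the chain below `τ`. It sends its `n + 1` elements into `{0, …, n}`,
hence onto. -/
theorem IsRootedTree.exists_le_height_eq (hT : IsRootedTree T) (τ : T) {k : ℕ}
    (hk : k ≤ height τ) : ∃ σ ≤ τ, height σ = k := by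
  obtain ⟨n, ⟨e⟩⟩ := hT τ
  have hn : height τ = n := height_eq τ n ⟨e⟩
  have hinj : Set.InjOn height (Set.Iic τ) := fun a ha b hb h =>
    hT.eq_of_le_of_height_eq ha hb h
  have hsub : height '' Set.Iic τ ⊆ Set.Iic n := by
    rintro _ ⟨a, ha, rfl⟩
    exact hn ▸ hT.height_le ha
  have hcard : (Set.Iic n).ncard ≤ (height '' Set.Iic τ).ncard := by
    rw [hinj.ncard_image, ← Nat.card_coe_set_eq (Set.Iic τ),
      Nat.card_congr e.toEquiv, Nat.card_fin, ← Nat.card_coe_set_eq]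
    simp
  have := Set.eq_of_subset_of_ncard_le hsub hcard (Set.finite_Iic n)
  have hk' : k ∈ height '' Set.Iic τ := by rw [this]; exact hn ▸ hk
  obtain ⟨σ, hσ, h⟩ := hk'
  exact ⟨σ, hσ, h⟩

theorem height_bot : height (⊥ : T) = 0 := by
  simp [height]

theorem IsRootedTree.bot_lt_of_height_pos (_hT : IsRootedTree T) {τ : T} (h : 0 < height τ) :
    ⊥ < τ := by
  rcases eq_or_ne τ ⊥ with rfl | h'
  · simp [height_bot] at h
  · exact bot_lt_iff_ne_bot.mpr h'

theorem IsRootedTree.height_pos (hT : IsRootedTree T) {τ : T} (h : ⊥ < τ) : 0 < height τ := by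
  have := hT.height_lt h
  rwa [height_bot] at this

theorem IsRootedTree.eq_bot_of_height_eq_zero (hT : IsRootedTree T) {τ : T} (h : height τ = 0) :
    τ = ⊥ := by
  by_contra h'
  exact (hT.height_pos (bot_lt_iff_ne_bot.mpr h')).ne' h

theorem IsRootedTree.trunc_eq (hT : IsRootedTree T) {σ τ : T} (h : σ ≤ τ) {k : ℕ}
    (hk : height σ = k) : trunc τ k = σ := by
  have hex : ∃ σ : T, σ ≤ τ ∧ height σ = k := ⟨σ, h, hk⟩
  rw [trunc, dif_pos hex]
  exact hT.eq_of_le_of_height_eq hex.choose_spec.1 h (hex.choose_spec.2.trans hk.symm)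

theorem IsRootedTree.exists_parent (hT : IsRootedTree T) {c : T} (hc : ⊥ < c) :
    ∃ p, c ∈ successors p := by
  have h := hT.height_pos hc
  obtain ⟨p, hp, hp'⟩ := hT.exists_le_height_eq c (Nat.sub_le (height c) 1)
  refine ⟨p, lt_of_le_of_ne hp ?_, by omega⟩
  rintro rfl
  omega

theorem bot_lt_of_mem_successors {p c : T} (h : c ∈ successors p) : ⊥ < c :=
  bot_le.trans_lt h.1

theorem IsRootedTree.induction (hT : IsRootedTree T) {P : T → Prop} (h0 : P ⊥)
    (hs : ∀ p c, c ∈ successors p → P p → P c) (τ : T) : P τ := by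
  induction hn : height τ generalizing τ with
  | zero =>
    rcases eq_or_ne τ ⊥ with rfl | h
    · exact h0
    · have := hT.height_pos (bot_lt_iff_ne_bot.mpr h)
      omega
  | succ n ih =>
    obtain ⟨p, hp⟩ := hT.exists_parent (hT.bot_lt_of_height_pos (τ := τ) (by omega))
    refine hs p τ hp (ih p ?_)
    have := hp.2
    omega

theorem Phi_bot {M : Type*} (φ : T → M → M) : Phi φ ⊥ = id := by
  rw [Phi, height_bot]
  rfl

theorem IsRootedTree.Phi_successor (hT : IsRootedTree T) {M : Type*} (φ : T → M → M) {p c : T}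
    (hc : c ∈ successors p) : Phi φ c = Phi φ p ∘ φ c := by
  have key : ∀ k ≤ height p, partialComp φ c k = partialComp φ p k := by
    intro k
    induction k with
    | zero => intro _; rfl
    | succ k ih =>
      intro hk
      obtain ⟨σ, hσ, hσ'⟩ := hT.exists_le_height_eq p hk
      rw [partialComp, partialComp, ih (by omega), hT.trunc_eq hσ hσ',
        hT.trunc_eq (hσ.trans hc.1.le) hσ']
  rw [Phi, hc.2, partialComp, key _ le_rfl, hT.trunc_eq le_rfl hc.2]
  rfl

theorem finite_height_eq (hT : IsRootedTree T) (hT' : IsPrunedFinitelySplitting T) (n : ℕ) :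
    {τ : T | height τ = n}.Finite := by
  induction n with
  | zero =>
    refine (Set.finite_singleton (⊥ : T)).subset fun τ hτ => ?_
    by_contra h
    have := hT.height_pos (bot_lt_iff_ne_bot.mpr h)
    simp only [Set.mem_ofPred_eq] at hτ
    omega
  | succ n ih =>
    refine (ih.biUnion fun p _ => (hT' p).2).subset fun τ hτ => ?_
    simp only [Set.mem_ofPred_eq] at hτ
    obtain ⟨p, hp⟩ := hT.exists_parent (hT.bot_lt_of_height_pos (τ := τ) (by omega))
    have := hp.2
    exact Set.mem_biUnion (show height p = n by omega) hp

theorem finite_height_le (hT : IsRootedTree T) (hT' : IsPrunedFinitelySplitting T) (n : ℕ) :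
    {τ : T | height τ ≤ n}.Finite :=
  ((Set.finite_Iic n).biUnion fun k _ => finite_height_eq hT hT' k).subset fun τ hτ =>
    Set.mem_biUnion (show height τ ∈ Set.Iic n from hτ) rfl

omit [OrderBot T] in
theorem exists_ge_height_eq (hT' : IsPrunedFinitelySplitting T) (τ : T) {n : ℕ}
    (h : height τ ≤ n) : ∃ σ, τ ≤ σ ∧ height σ = n := by
  induction n, h using Nat.le_induction with
  | base => exact ⟨τ, le_rfl, rfl⟩
  | succ n _ ih =>
    obtain ⟨σ, hσ, hσ'⟩ := ih
    obtain ⟨ρ, hρ⟩ := (hT' σ).1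
    exact ⟨ρ, hσ.trans hρ.1.le, by rw [hρ.2, hσ']⟩

theorem height_of_mem_boundary {ω : ℕ → T} (hω : ω ∈ boundary T) (n : ℕ) : height (ω n) = n := by
  induction n with
  | zero => rw [hω.1, height_bot]
  | succ n ih => rw [(hω.2 n).2, ih]

theorem strictMono_of_mem_boundary {ω : ℕ → T} (hω : ω ∈ boundary T) : StrictMono ω :=
  strictMono_nat_of_lt_succ fun n => (hω.2 n).1

theorem eq_of_le_of_mem_boundary (hT : IsRootedTree T) {ω : ℕ → T} (hω : ω ∈ boundary T) {n : ℕ}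
    {a : T} (ha : a ≤ ω n) : a = ω (height a) := by
  have h : height a ≤ n := height_of_mem_boundary hω n ▸ hT.height_le ha
  exact hT.eq_of_le_of_height_eq ha ((strictMono_of_mem_boundary hω).monotone h)
    (height_of_mem_boundary hω _).symm

/-- **König's lemma** for cut sets: a set of vertices that meets every infinite path meets
all paths below a certain level. -/
theorem exists_height_forall_exists_le (hT : IsRootedTree T) (hT' : IsPrunedFinitelySplitting T)
    {C : Set T} (hC : ∀ ω ∈ boundary T, ∃ n, ω n ∈ C) :
    ∃ n, ∀ τ : T, height τ = n → ∃ c ∈ C, c ≤ τ := by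
  by_contra! hcon
  -- A vertex is good if every level below it contains a descendant not cut off by `C`. An infinite
  -- path of good vertices would avoid `C`.
  let G : T → Prop := fun σ => ∀ n, height σ ≤ n → ∃ τ, σ ≤ τ ∧ height τ = n ∧ ∀ c ∈ C, ¬ c ≤ τ
  have hbot : G ⊥ := fun n _ => by
    obtain ⟨τ, h1, h2⟩ := hcon n
    exact ⟨τ, bot_le, h1, h2⟩
  have hstep : ∀ σ, G σ → ∃ ρ ∈ successors σ, G ρ := by
    intro σ hσ
    by_contra! h
    have h' : ∀ ρ : T, ∃ n, ρ ∈ successors σ → height ρ ≤ n ∧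
        ∀ τ, ρ ≤ τ → height τ = n → ∃ c ∈ C, c ≤ τ := by
      intro ρ
      by_cases hρ : ρ ∈ successors σ
      · have := h ρ hρ
        simp only [G, not_forall, not_exists, not_and, not_not] at this
        obtain ⟨n, hn, hn'⟩ := this
        exact ⟨n, fun _ => ⟨hn, fun τ h1 h2 => by simpa using hn' τ h1 h2⟩⟩
      · exact ⟨0, fun h => absurd h hρ⟩
    choose N hN using h'
    obtain ⟨ρ₀, hρ₀⟩ := (hT' σ).1
    obtain ⟨B, hB⟩ := ((hT' σ).2.image N).bddAbove
    have hB' : ∀ ρ ∈ successors σ, N ρ ≤ B := fun ρ hρ => hB ⟨ρ, hρ, rfl⟩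
    have hσB : height σ + 1 ≤ B := by
      have := (hN ρ₀ hρ₀).1
      have := hB' ρ₀ hρ₀
      have := hρ₀.2
      omega
    obtain ⟨τ, h1, h2, h3⟩ := hσ B (by omega)
    obtain ⟨ρ, hρτ, hρh⟩ := hT.exists_le_height_eq τ (k := height σ + 1) (by omega)
    have hρ : ρ ∈ successors σ := by
      refine ⟨lt_of_le_of_ne (hT.le_of_height_le h1 hρτ (by omega)) ?_, hρh⟩
      rintro rfl
      omega
    obtain ⟨τ', hτ', hτh⟩ := hT.exists_le_height_eq τ (k := N ρ) (h2 ▸ hB' ρ hρ)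
    have hρτ' : ρ ≤ τ' := hT.le_of_height_le hρτ hτ' (by rw [hτh]; exact (hN ρ hρ).1)
    obtain ⟨c, hc, hcτ⟩ := (hN ρ hρ).2 τ' hρτ' hτh
    exact h3 c hc (hcτ.trans hτ')
  choose! f hf hfG using hstep
  let ω : ℕ → T := fun n => f^[n] ⊥
  have hωG : ∀ n, G (ω n) := by
    intro n
    induction n with
    | zero => exact hbot
    | succ n ih =>
      simp only [ω, Function.iterate_succ_apply']
      exact hfG _ ih
  have hω : ω ∈ boundary T := by
    refine ⟨rfl, fun n => ?_⟩
    simp only [ω, Function.iterate_succ_apply']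
    exact hf _ (hωG n)
  obtain ⟨n, hn⟩ := hC ω hω
  obtain ⟨τ, h1, -, h3⟩ := hωG n _ le_rfl
  exact h3 _ hn h1

omit [OrderBot T] in
theorem IsMaximalAntichainIn.exists_comparable {P A : Set T} (hA : IsMaximalAntichainIn P A)
    {τ : T} (hτ : τ ∈ P) : ∃ a ∈ A, a ≤ τ ∨ τ ≤ a := by
  by_contra! h
  have h2 : insert τ A ⊆ P ∧ IsAntichain (· ≤ ·) (insert τ A) :=
    ⟨Set.insert_subset hτ hA.prop.1, hA.prop.2.insert (fun b hb _ => (h b hb).1)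
      (fun b hb _ => (h b hb).2)⟩
  have h3 : insert τ A ⊆ A := hA.le_of_ge h2 (Set.subset_insert τ A)
  exact (h τ (h3 (Set.mem_insert τ A))).1 le_rfl

omit [OrderBot T] in
theorem isMaximalAntichainIn_of_exists_comparable {P A : Set T} (hP : A ⊆ P)
    (hA : IsAntichain (· ≤ ·) A) (h : ∀ τ ∈ P, ∃ a ∈ A, a ≤ τ ∨ τ ≤ a) :
    IsMaximalAntichainIn P A := by
  refine ⟨⟨hP, hA⟩, fun B hB hAB b hb => ?_⟩
  obtain ⟨a, ha, hab | hab⟩ := h b (hB.1 hb)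
  · rwa [← hB.2.eq (hAB ha) hb hab]
  · rwa [hB.2.eq hb (hAB ha) hab]

/-- A vertex above level `n` has an ancestor at level `n`, which is comparable to some element of
`A`. That element has height at most `n`, so it lies below the ancestor. For `n = 0` this fails,
since there `A` is empty. -/
theorem IsMaximalAntichainIn.belowLevel_mono (hT : IsRootedTree T) {n m : ℕ} (hn : 1 ≤ n)
    (hnm : n ≤ m) {A : Set T} (hA : IsMaximalAntichainIn (belowLevel T n) A) :
    IsMaximalAntichainIn (belowLevel T m) A := by
  refine isMaximalAntichainIn_of_exists_comparable
    (fun a ha => ⟨(hA.prop.1 ha).1, (hA.prop.1 ha).2.trans hnm⟩) hA.prop.2 fun τ hτ => ?_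
  rcases le_total (height τ) n with h | h
  · exact hA.exists_comparable ⟨hτ.1, h⟩
  · obtain ⟨σ, hσ, hσh⟩ := hT.exists_le_height_eq τ h
    obtain ⟨a, ha, haσ⟩ := hA.exists_comparable (τ := σ)
      ⟨hT.bot_lt_of_height_pos (by omega), hσh.le⟩
    refine ⟨a, ha, Or.inl ?_⟩
    rcases haσ with h' | h'
    · exact h'.trans hσ
    · rcases h'.eq_or_lt with h'' | h''
      · exact h'' ▸ hσ
      · have := hT.height_lt h''
        have := (hA.prop.1 ha).2
        omega

/-- The minimal elements of a cut set form a finite maximal antichain. -/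
theorem exists_isMaximalAntichainIn_subset (hT : IsRootedTree T)
    (hT' : IsPrunedFinitelySplitting T) {C : Set T} (hC0 : ⊥ ∉ C) {n : ℕ}
    (hC : ∀ τ : T, height τ = n → ∃ c ∈ C, c ≤ τ) :
    ∃ A : Finset T, (A : Set T) ⊆ C ∧ IsMaximalAntichainIn (belowLevel T n) (A : Set T) := by
  have hfin : (C ∩ belowLevel T n).Finite :=
    (finite_height_le hT hT' n).subset fun τ hτ => hτ.2.2
  let A : Set T := {a | Minimal (· ∈ C ∩ belowLevel T n) a}
  have hAfin : A.Finite := hfin.subset fun a ha => ha.prop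
  refine ⟨hAfin.toFinset, fun a ha => ?_, ?_⟩
  · exact (hAfin.mem_toFinset.mp ha).prop.1
  · rw [hAfin.coe_toFinset]
    refine isMaximalAntichainIn_of_exists_comparable (fun a ha => ha.prop.2) ?_ ?_
    · intro a ha b hb hab hle
      exact hab (le_antisymm hle (hb.le_of_le ha.prop hle))
    · intro τ hτ
      obtain ⟨σ, hτσ, hσ⟩ := exists_ge_height_eq hT' τ hτ.2
      obtain ⟨c, hc, hcσ⟩ := hC σ hσ
      have hc' : c ∈ C ∩ belowLevel T n :=
        ⟨hc, bot_lt_iff_ne_bot.mpr (fun h => hC0 (h ▸ hc)), hσ ▸ hT.height_le hcσ⟩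
      obtain ⟨a, hac, ha⟩ := hfin.exists_le_minimal hc'
      exact ⟨a, ha, hT.total_of_le (hac.trans hcσ) hτσ⟩

theorem exists_isMaximalAntichainIn_belowLevel (hT : IsRootedTree T)
    (hT' : IsPrunedFinitelySplitting T) {n : ℕ} (hn : 1 ≤ n) :
    ∃ A : Finset T, IsMaximalAntichainIn (belowLevel T n) (A : Set T) := by
  obtain ⟨A, -, hA⟩ := exists_isMaximalAntichainIn_subset hT hT' (C := {⊥}ᶜ) (by simp) (n := n)
    fun τ hτ => ⟨τ, fun h => by
      rw [Set.mem_singleton_iff] at h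
      rw [h, height_bot] at hτ
      omega, le_rfl⟩
  exact ⟨A, hA⟩

/-- Under subexponential splitting, the number of successors of a vertex of height `n` is at most
a constant times `exp (η n)`. -/
theorem SubexponentialSplitting.exists_bound (hT : IsRootedTree T)
    (hT' : IsPrunedFinitelySplitting T) (h : SubexponentialSplitting T) {η : ℝ} (hη : 0 < η) :
    ∃ B : ℝ, 0 < B ∧ ∀ τ : T, ((successors τ).ncard : ℝ) ≤ B * Real.exp η ^ height τ := by
  have h1 := h.eventually (gt_mem_nhds hη)
  rw [eventually_comap] at h1
  obtain ⟨N, hN⟩ := eventually_atTop.mp h1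
  obtain ⟨B, hB⟩ := ((finite_height_le hT hT' N).image
    fun τ : T => ((successors τ).ncard : ℝ)).bddAbove
  have hpow : ∀ n : ℕ, 1 ≤ Real.exp η ^ n := fun n => one_le_pow₀ (Real.one_le_exp hη.le)
  refine ⟨max B 1, by positivity, fun τ => ?_⟩
  rcases le_or_gt (height τ) N with hτ | hτ
  · have h2 : ((successors τ).ncard : ℝ) ≤ B := hB ⟨τ, hτ, rfl⟩
    have := hpow (height τ)
    nlinarith [le_max_left B 1, le_max_right B 1]
  · have h2 := hN _ hτ.le τ rfl
    have h3 : (0 : ℝ) < height τ := by exact_mod_cast (Nat.zero_le N).trans_lt hτ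
    have h4 : 0 < (successors τ).ncard := (Set.ncard_pos (hT' τ).2).mpr (hT' τ).1
    have h5 : Real.log ((successors τ).ncard : ℝ) ≤ height τ * η := by
      rw [one_div, inv_mul_lt_iff₀ h3] at h2
      exact h2.le
    have h6 : ((successors τ).ncard : ℝ) ≤ Real.exp η ^ height τ := by
      rw [← Real.exp_nat_mul]
      exact (Real.log_le_iff_le_exp (by exact_mod_cast h4)).mp h5
    exact h6.trans (le_mul_of_one_le_left (by positivity) (le_max_right _ _))

end Tree
end TreeIFS

/-! ### Conformal maps, propagation of the open set condition, and cones. -/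

namespace TreeIFS

section Geometry

open MeasureTheory Pointwise

variable {d : ℕ}

theorem nontrivial_euclideanSpace (hd : 0 < d) : Nontrivial (EuclideanSpace ℝ (Fin d)) :=
  Module.nontrivial_of_finrank_pos (R := ℝ) (by simpa using hd)

theorem norm_smul_linearIsometry [Nontrivial (EuclideanSpace ℝ (Fin d))] {c : ℝ}
    {li : EuclideanSpace ℝ (Fin d) →ₗᵢ[ℝ] EuclideanSpace ℝ (Fin d)} :
    ‖c • li.toContinuousLinearMap‖ = |c| := by
  rw [norm_smul, LinearIsometry.norm_toContinuousLinearMap, mul_one, Real.norm_eq_abs]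

theorem _root_.IsConformalMap.surjective
    {f : EuclideanSpace ℝ (Fin d) →L[ℝ] EuclideanSpace ℝ (Fin d)} (hf : IsConformalMap f) :
    Function.Surjective f :=
  (LinearMap.injective_iff_surjective (f := f.toLinearMap)).mp hf.injective

/-- The Jacobian of a conformal map. -/
theorem _root_.IsConformalMap.abs_det_eq [Nontrivial (EuclideanSpace ℝ (Fin d))]
    {f : EuclideanSpace ℝ (Fin d) →L[ℝ] EuclideanSpace ℝ (Fin d)} (hf : IsConformalMap f) :
    |f.det| = ‖f‖ ^ d := by
  obtain ⟨c, hc, li, rfl⟩ := hf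
  rw [norm_smul_linearIsometry]
  let e : EuclideanSpace ℝ (Fin d) ≃ₗᵢ[ℝ] EuclideanSpace ℝ (Fin d) := li.toLinearIsometryEquiv rfl
  have he : ∀ x, li x = e x := fun x => rfl
  -- The determinant is read off from volumes: the unit ball is mapped onto the ball of radius
  -- `|c|`.
  have himg : (c • li.toContinuousLinearMap) '' Metric.ball 0 1 = Metric.ball 0 |c| := by
    have h1 : (c • li.toContinuousLinearMap) '' Metric.ball 0 1
        = c • (e '' Metric.ball (0 : EuclideanSpace ℝ (Fin d)) 1) := by
      rw [← Set.image_smul, Set.image_image]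
      rfl
    rw [h1, LinearIsometryEquiv.image_ball, map_zero, smul_ball hc, smul_zero, mul_one,
      Real.norm_eq_abs]
  have h2 := Measure.addHaar_image_continuousLinearMap (volume : Measure (EuclideanSpace ℝ (Fin d)))
    (c • li.toContinuousLinearMap) (Metric.ball 0 1)
  rw [himg, Measure.addHaar_ball _ _ (abs_nonneg c), finrank_euclideanSpace_fin,
    ENNReal.mul_left_inj (Metric.measure_ball_pos _ _ one_pos).ne' measure_ball_lt_top.ne,
    ENNReal.ofReal_eq_ofReal_iff (by positivity) (by positivity)] at h2
  exact h2.symm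

/-- A neighbourhood `V` of `X` on which the maps of a tree iterated function system are conformal
with distortion bounded by `K`. -/
structure IsConformalDomain {T : Type*} [PartialOrder T] [OrderBot T]
    (X : Set (EuclideanSpace ℝ (Fin d))) (φ : T → EuclideanSpace ℝ (Fin d) → EuclideanSpace ℝ (Fin d))
    (V : Set (EuclideanSpace ℝ (Fin d))) (K : ℝ) : Prop where
  isOpen : IsOpen V
  subset : X ⊆ V
  mapsTo : ∀ τ : T, τ ≠ ⊥ → Set.MapsTo (φ τ) V V
  injOn : ∀ τ : T, τ ≠ ⊥ → Set.InjOn (φ τ) V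
  contDiffOn : ∀ τ : T, τ ≠ ⊥ → ContDiffOn ℝ 1 (φ τ) V
  conformalAt : ∀ τ : T, τ ≠ ⊥ → ∀ x ∈ V, ConformalAt (φ τ) x
  one_le : 1 ≤ K
  distortion : ∀ τ : T, ∀ x ∈ V, ∀ y ∈ V,
    ‖fderiv ℝ (Phi φ τ) x‖ ≤ K * ‖fderiv ℝ (Phi φ τ) y‖

variable {T : Type*} [PartialOrder T] [OrderBot T] {X V : Set (EuclideanSpace ℝ (Fin d))} {φ : T → EuclideanSpace ℝ (Fin d) → EuclideanSpace ℝ (Fin d)} {K : ℝ}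

theorem IsConformalTIFS.exists_isConformalDomain (h : IsConformalTIFS X φ) :
    ∃ V K, IsConformalDomain X φ V K := by
  obtain ⟨V, hV, hX, h1, K, hK, h2⟩ := h.conformal_distortion
  exact ⟨V, K, hV, hX, fun τ hτ => (h1 τ hτ).1, fun τ hτ => (h1 τ hτ).2.1,
    fun τ hτ => (h1 τ hτ).2.2.1, fun τ hτ => (h1 τ hτ).2.2.2, hK, h2⟩

namespace IsConformalDomain

theorem Phi_mapsTo (h : IsConformalDomain X φ V K) (hT : IsRootedTree T) (τ : T) :
    Set.MapsTo (Phi φ τ) V V := by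
  refine hT.induction (P := fun τ => Set.MapsTo (Phi φ τ) V V) ?_ (fun p c hc ih => ?_) τ
  · rw [Phi_bot]; exact Set.mapsTo_id V
  · rw [hT.Phi_successor φ hc]
    exact ih.comp (h.mapsTo c (bot_lt_of_mem_successors hc).ne')

theorem Phi_injOn (h : IsConformalDomain X φ V K) (hT : IsRootedTree T) (τ : T) :
    Set.InjOn (Phi φ τ) V := by
  refine hT.induction (P := fun τ => Set.InjOn (Phi φ τ) V) ?_ (fun p c hc ih => ?_) τ
  · rw [Phi_bot]; exact Set.injOn_id V
  · rw [hT.Phi_successor φ hc]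
    have hc' := (bot_lt_of_mem_successors hc).ne'
    exact ih.comp (h.injOn c hc') (h.mapsTo c hc')

theorem Phi_conformalAt (h : IsConformalDomain X φ V K) (hT : IsRootedTree T) (τ : T) :
    ∀ x ∈ V, ConformalAt (Phi φ τ) x := by
  refine hT.induction (P := fun τ => ∀ x ∈ V, ConformalAt (Phi φ τ) x) ?_
    (fun p c hc ih x hx => ?_) τ
  · rw [Phi_bot]; exact fun x _ => conformalAt_id x
  · rw [hT.Phi_successor φ hc]
    have hc' := (bot_lt_of_mem_successors hc).ne'
    exact (ih _ (h.mapsTo c hc' hx)).comp x (h.conformalAt c hc' x hx)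

/-- A conformal derivative is injective, hence surjective in equal finite dimensions, so the map is
open near each point. -/
theorem isOpen_image (h : IsConformalDomain X φ V K) {τ : T} (hτ : τ ≠ ⊥) {U : Set (EuclideanSpace ℝ (Fin d))}
    (hU : IsOpen U) (hUV : U ⊆ V) : IsOpen (φ τ '' U) := by
  rw [isOpen_iff_mem_nhds]
  rintro _ ⟨x, hx, rfl⟩
  have h1 : HasStrictFDerivAt (φ τ) (fderiv ℝ (φ τ) x) x :=
    ((h.contDiffOn τ hτ).contDiffAt (h.isOpen.mem_nhds (hUV hx))).hasStrictFDerivAt one_ne_zero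
  have h2 : IsConformalMap (fderiv ℝ (φ τ) x) :=
    conformalAt_iff_isConformalMap_fderiv.mp (h.conformalAt τ hτ x (hUV hx))
  have h3 := h1.map_nhds_eq_of_surj (LinearMap.range_eq_top.mpr h2.surjective)
  rw [← h3]
  exact image_mem_map (hU.mem_nhds hx)

theorem bddAbove_norm_fderiv (h : IsConformalDomain X φ V K) (τ : T) :
    BddAbove (Set.range fun x : X => ‖fderiv ℝ (Phi φ τ) (x : EuclideanSpace ℝ (Fin d))‖) := by
  rcases X.eq_empty_or_nonempty with rfl | ⟨x₀, hx₀⟩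
  · exact ⟨0, by rintro _ ⟨⟨x, hx⟩, rfl⟩; exact absurd hx (Set.notMem_empty x)⟩
  · refine ⟨K * ‖fderiv ℝ (Phi φ τ) x₀‖, ?_⟩
    rintro _ ⟨x, rfl⟩
    exact h.distortion τ x (h.subset x.2) x₀ (h.subset hx₀)

theorem norm_fderiv_le_derivNorm (h : IsConformalDomain X φ V K) (τ : T) {x : EuclideanSpace ℝ (Fin d)} (hx : x ∈ X) :
    ‖fderiv ℝ (Phi φ τ) x‖ ≤ derivNorm X φ τ :=
  le_ciSup (h.bddAbove_norm_fderiv τ) ⟨x, hx⟩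

theorem norm_fderiv_le (h : IsConformalDomain X φ V K) (hX : X.Nonempty) (τ : T) {x : EuclideanSpace ℝ (Fin d)}
    (hx : x ∈ V) : ‖fderiv ℝ (Phi φ τ) x‖ ≤ K * derivNorm X φ τ := by
  obtain ⟨y, hy⟩ := hX
  refine (h.distortion τ x hx y (h.subset hy)).trans ?_
  have := h.one_le
  gcongr
  exact h.norm_fderiv_le_derivNorm τ hy

theorem derivNorm_le (h : IsConformalDomain X φ V K) (hX : X.Nonempty) (τ : T) {x : EuclideanSpace ℝ (Fin d)}
    (hx : x ∈ V) : derivNorm X φ τ ≤ K * ‖fderiv ℝ (Phi φ τ) x‖ := by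
  have : Nonempty X := hX.to_subtype
  exact ciSup_le fun y => h.distortion τ y (h.subset y.2) x hx

omit [OrderBot T] in
theorem derivNorm_nonneg (τ : T) : 0 ≤ derivNorm X φ τ :=
  Real.iSup_nonneg fun _ => norm_nonneg _

theorem derivNorm_bot [Nontrivial (EuclideanSpace ℝ (Fin d))] (hX : X.Nonempty) : derivNorm X φ ⊥ = 1 := by
  have : Nonempty X := hX.to_subtype
  simp only [derivNorm, Phi_bot, fderiv_id, ContinuousLinearMap.norm_id, ciSup_const]

/-- On balls contained in `V`, the map `Φ_τ` is Lipschitz with constant `K ‖Φ_τ'‖`. -/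
theorem dist_Phi_le_of_mem_ball (h : IsConformalDomain X φ V K) (hT : IsRootedTree T)
    (hX : X.Nonempty) (τ : T) {w : EuclideanSpace ℝ (Fin d)} {δ : ℝ} (hw : Metric.ball w δ ⊆ V) {x y : EuclideanSpace ℝ (Fin d)}
    (hx : x ∈ Metric.ball w δ) (hy : y ∈ Metric.ball w δ) :
    dist (Phi φ τ x) (Phi φ τ y) ≤ K * derivNorm X φ τ * dist x y := by
  rw [dist_eq_norm, dist_eq_norm]
  exact Convex.norm_image_sub_le_of_norm_fderiv_le (𝕜 := ℝ)
    (fun z hz => (h.Phi_conformalAt hT τ z (hw hz)).differentiableAt)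
    (fun z hz => h.norm_fderiv_le hX τ (hw hz)) (convex_ball w δ) hy hx

/-- The volume of the image of a ball contained in `V`. -/
theorem le_volume_image (h : IsConformalDomain X φ V K) (hT : IsRootedTree T) [Nontrivial (EuclideanSpace ℝ (Fin d))]
    (hX : X.Nonempty) (τ : T) {s : Set (EuclideanSpace ℝ (Fin d))} (hs : MeasurableSet s) (hsV : s ⊆ V) :
    ENNReal.ofReal ((derivNorm X φ τ / K) ^ d) * volume s ≤ volume (Phi φ τ '' s) := by
  have hK : 0 < K := one_pos.trans_le h.one_le
  rw [← lintegral_abs_det_fderiv_eq_addHaar_image volume hs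
    (fun x hx => (h.Phi_conformalAt hT τ x (hsV hx)).differentiableAt.hasFDerivAt.hasFDerivWithinAt)
    ((h.Phi_injOn hT τ).mono hsV), ← setLIntegral_const]
  refine setLIntegral_mono' hs fun x hx => ENNReal.ofReal_le_ofReal ?_
  rw [(conformalAt_iff_isConformalMap_fderiv.mp (h.Phi_conformalAt hT τ x (hsV hx))).abs_det_eq]
  have := derivNorm_nonneg (X := X) (φ := φ) τ
  gcongr
  rw [div_le_iff₀' hK]
  exact h.derivNorm_le hX τ (hsV hx)

end IsConformalDomain

theorem IsTIFS.Phi_mapsTo {M : Type*} [MetricSpace M] {X : Set M} {φ : T → M → M}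
    (h : IsTIFS X φ) (hT : IsRootedTree T) (τ : T) : Set.MapsTo (Phi φ τ) X X := by
  refine hT.induction (P := fun τ => Set.MapsTo (Phi φ τ) X X) ?_ (fun p c hc ih => ?_) τ
  · rw [Phi_bot]; exact Set.mapsTo_id X
  · rw [hT.Phi_successor φ hc]
    exact ih.comp (h.mapsTo c (bot_lt_of_mem_successors hc).ne')

theorem dist_Phi_le {M : Type*} [MetricSpace M] {X : Set M} {φ : T → M → M}
    (h : IsTIFS X φ) (hT : IsRootedTree T) {s : ℝ} (hs0 : 0 < s)
    (hs : ∀ τ : T, τ ≠ ⊥ → ∀ x ∈ X, ∀ y ∈ X, dist (φ τ x) (φ τ y) ≤ s * dist x y) (τ : T) :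
    ∀ x ∈ X, ∀ y ∈ X, dist (Phi φ τ x) (Phi φ τ y) ≤ s ^ height τ * dist x y := by
  refine hT.induction
    (P := fun τ => ∀ x ∈ X, ∀ y ∈ X, dist (Phi φ τ x) (Phi φ τ y) ≤ s ^ height τ * dist x y) ?_
    (fun p c hc ih x hx y hy => ?_) τ
  · rw [Phi_bot, height_bot]; simp
  · have hc' := (bot_lt_of_mem_successors hc).ne'
    rw [hT.Phi_successor φ hc, hc.2, pow_succ, mul_assoc]
    refine (ih _ (h.mapsTo c hc' hx) _ (h.mapsTo c hc' hy)).trans ?_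
    gcongr
    exact hs c hc' x hx y hy

/-- Every infinite path determines a point of the limit set. -/
theorem IsTIFS.exists_mem_limitSet {M : Type*} [MetricSpace M] {X : Set M} {φ : T → M → M}
    (h : IsTIFS X φ) (hT : IsRootedTree T) {ω : ℕ → T} (hω : ω ∈ boundary T) :
    ∃ x ∈ limitSet X φ, ∀ n, x ∈ Phi φ (ω n) '' X := by
  obtain ⟨s, hs0, hs1, hs⟩ := h.contracting
  have hanti : ∀ n, Phi φ (ω (n + 1)) '' X ⊆ Phi φ (ω n) '' X := fun n => by
    rw [hT.Phi_successor φ (hω.2 n), Set.image_comp]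
    exact Set.image_mono (h.mapsTo _ (bot_lt_of_mem_successors (hω.2 n)).ne').image_subset
  have hlip := dist_Phi_le h hT hs0 hs
  have hcpt : ∀ n, IsCompact (Phi φ (ω n) '' X) := fun n => by
    refine h.isCompact.image_of_continuousOn ?_
    refine (LipschitzOnWith.of_dist_le_mul (K := (⟨s, hs0.le⟩ : NNReal) ^ height (ω n)) ?_).continuousOn
    intro x hx y hy
    exact hlip _ x hx y hy
  obtain ⟨x, hx⟩ := IsCompact.nonempty_iInter_of_sequence_nonempty_isCompact_isClosed
    (fun n => Phi φ (ω n) '' X) hanti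
    (fun n => h.isConnected.nonempty.image _) (hcpt 0) (fun n => (hcpt n).isClosed)
  rw [Set.mem_iInter] at hx
  refine ⟨x, ⟨ω, hω, Set.eq_singleton_iff_unique_mem.mpr
    ⟨Set.mem_iInter₂.mpr fun n _ => hx n, fun y hy => ?_⟩⟩, hx⟩
  rw [Set.mem_iInter₂] at hy
  -- Uniqueness of the point: the diameters of the nested pieces shrink geometrically.
  have hbound : ∀ n : ℕ, dist y x ≤ s ^ (n + 1) * Metric.diam X := fun n => by
    obtain ⟨a, ha, rfl⟩ := hy (n + 1) (by simp)
    obtain ⟨b, hb, hb'⟩ := hx (n + 1)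
    rw [← hb']
    refine (hlip _ a ha b hb).trans ?_
    rw [height_of_mem_boundary hω]
    gcongr
    exact Metric.dist_le_diam_of_mem h.isCompact.isBounded ha hb
  have hlim : Tendsto (fun n : ℕ => s ^ (n + 1) * Metric.diam X) atTop (𝓝 0) := by
    simpa using ((tendsto_pow_atTop_nhds_zero_of_lt_one hs0.le hs1).comp
      (tendsto_add_atTop_nat 1)).mul_const (Metric.diam X)
  exact dist_le_zero.mp (ge_of_tendsto' hlim hbound)

namespace IsConformalDomain

theorem image_interior_subset (h : IsConformalDomain X φ V K) (hX : IsTIFS X φ) {τ : T}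
    (hτ : τ ≠ ⊥) : φ τ '' interior X ⊆ interior X :=
  interior_maximal ((Set.image_mono interior_subset).trans (hX.mapsTo τ hτ).image_subset)
    (h.isOpen_image hτ isOpen_interior (interior_subset.trans h.subset))

theorem Phi_image_interior_subset (h : IsConformalDomain X φ V K) (hT : IsRootedTree T)
    (hX : IsTIFS X φ) {p c : T} (hc : c ∈ successors p) :
    Phi φ c '' interior X ⊆ Phi φ p '' interior X := by
  rw [hT.Phi_successor φ hc, Set.image_comp]
  exact Set.image_mono (h.image_interior_subset hX (bot_lt_of_mem_successors hc).ne')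

/-- The open set condition propagates to all levels. -/
theorem disjoint_Phi_image_interior (h : IsConformalDomain X φ V K) (hT : IsRootedTree T)
    (hX : IsConformalTIFS X φ) {n : ℕ} {p q : T} (hp : height p = n) (hq : height q = n)
    (hpq : p ≠ q) : Disjoint (Phi φ p '' interior X) (Phi φ q '' interior X) := by
  induction n generalizing p q with
  | zero =>
    exact absurd ((hT.eq_bot_of_height_eq_zero hp).trans (hT.eq_bot_of_height_eq_zero hq).symm) hpq
  | succ n ih =>
    obtain ⟨p', hp'⟩ := hT.exists_parent (hT.bot_lt_of_height_pos (τ := p) (by omega))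
    obtain ⟨q', hq'⟩ := hT.exists_parent (hT.bot_lt_of_height_pos (τ := q) (by omega))
    -- For equal parents, the open set condition is transported by the injective map of the parent.
    -- For distinct parents, the images lie inside sets already disjoint by induction.
    rcases eq_or_ne p' q' with rfl | hne
    · rw [hT.Phi_successor φ hp', hT.Phi_successor φ hq', Set.image_comp, Set.image_comp]
      refine Set.disjoint_image_image fun x hx y hy hxy => ?_
      have h1 : ∀ {c}, c ∈ successors p' → φ c '' interior X ⊆ V := fun {c} hc =>
        (h.image_interior_subset hX.toIsTIFS (bot_lt_of_mem_successors hc).ne').trans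
          (interior_subset.trans h.subset)
      have := h.Phi_injOn hT p' (h1 hp' hx) (h1 hq' hy) hxy
      exact Set.disjoint_left.mp (hX.open_set_condition p' p hp' q hq' hpq) hx (this ▸ hy)
    · exact (ih (by have := hp'.2; omega) (by have := hq'.2; omega) hne).mono
        (h.Phi_image_interior_subset hT hX.toIsTIFS hp')
        (h.Phi_image_interior_subset hT hX.toIsTIFS hq')

end IsConformalDomain

/-- A cone of angle `α` contains balls whose radius is proportional to the distance from the
vertex. -/
theorem ball_subset_openCone {x v : EuclideanSpace ℝ (Fin d)} (hv : ‖v‖ = 1) {α l c h : ℝ} (hc0 : 0 < c) (hc1 : c < 1)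
    (hc : 2 * c ≤ 1 - Real.cos α) (h0 : 0 < h) (hl : 2 * h ≤ l) :
    Metric.ball (x + h • v) (c * h) ⊆ openCone x α l v := by
  intro y hy
  obtain ⟨u, rfl⟩ : ∃ u, y = x + h • v + u := ⟨y - (x + h • v), by abel⟩
  rw [Metric.mem_ball, dist_eq_norm, add_sub_cancel_left] at hy
  have hsub : x + h • v + u - x = h • v + u := by abel
  have hnv : ‖h • v‖ = h := by rw [norm_smul, hv, mul_one, Real.norm_of_nonneg h0.le]
  have h1 : ‖h • v + u‖ ≤ h + ‖u‖ := (norm_add_le _ _).trans_eq (by rw [hnv])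
  have h2 : h - ‖u‖ ≤ ‖h • v + u‖ := by
    have := norm_sub_le (h • v + u) u
    rw [add_sub_cancel_right, hnv] at this
    linarith
  have h3 : |inner ℝ u v| ≤ ‖u‖ := by simpa [hv] using abs_real_inner_le_norm u v
  have h4 : inner ℝ (h • v + u) v = h + inner ℝ u v := by
    rw [inner_add_left, real_inner_smul_left, real_inner_self_eq_norm_sq, hv]
    ring
  have h5 := (abs_le.mp h3).1
  have hch : c * h < h := by nlinarith
  refine ⟨?_, ?_, ?_⟩ <;> rw [hsub]
  · linarith
  · linarith
  · rw [h4]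
    rcases le_or_gt (Real.cos α) 0 with hcos | hcos
    · have : ‖h • v + u‖ * Real.cos α ≤ 0 := mul_nonpos_of_nonneg_of_nonpos (norm_nonneg _) hcos
      linarith
    · have : ‖h • v + u‖ * Real.cos α ≤ (h + ‖u‖) * Real.cos α := by gcongr
      nlinarith [Real.cos_le_one α]

end Geometry
end TreeIFS

/-! ### Metric estimates: diameters, decay of derivatives, bounded multiplicity. -/

namespace TreeIFS

section Estimates

open MeasureTheory

variable {d : ℕ} {T : Type*} [PartialOrder T] [OrderBot T] {X V : Set (EuclideanSpace ℝ (Fin d))}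
  {φ : T → EuclideanSpace ℝ (Fin d) → EuclideanSpace ℝ (Fin d)} {K : ℝ}

namespace IsConformalDomain

theorem isOpen_Phi_image (h : IsConformalDomain X φ V K) (hT : IsRootedTree T) (τ : T) :
    ∀ U : Set (EuclideanSpace ℝ (Fin d)), IsOpen U → U ⊆ V → IsOpen (Phi φ τ '' U) := by
  refine hT.induction (P := fun τ => ∀ U : Set (EuclideanSpace ℝ (Fin d)), IsOpen U → U ⊆ V →
    IsOpen (Phi φ τ '' U)) (fun U hU _ => ?_) (fun p c hc ih U hU hUV => ?_) τ
  · rwa [Phi_bot, Set.image_id]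
  · have hc' := (bot_lt_of_mem_successors hc).ne'
    rw [hT.Phi_successor φ hc, Set.image_comp]
    exact ih _ (h.isOpen_image hc' hU hUV)
      ((Set.image_mono hUV).trans (h.mapsTo c hc').image_subset)

theorem exists_ball_subset (h : IsConformalDomain X φ V K) (hX : IsCompact X) :
    ∃ δ > 0, ∀ x ∈ X, Metric.ball x δ ⊆ V := by
  obtain ⟨δ, hδ, hV⟩ := hX.exists_thickening_subset_open h.isOpen h.subset
  exact ⟨δ, hδ, fun x hx => (Metric.ball_subset_thickening hx δ).trans hV⟩

/-- The diameter of `Φ_τ(X)` is at most a constant times `‖Φ_τ'‖`. -/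
theorem exists_dist_Phi_le (h : IsConformalDomain X φ V K) (hT : IsRootedTree T)
    (hX : IsTIFS X φ) :
    ∃ C : ℝ, 0 < C ∧ ∀ τ : T, ∀ x ∈ X, ∀ y ∈ X,
      dist (Phi φ τ x) (Phi φ τ y) ≤ C * derivNorm X φ τ := by
  obtain ⟨δ, hδ, hball⟩ := h.exists_ball_subset hX.isCompact
  have hne := hX.isConnected.nonempty
  have hK : 0 ≤ K := zero_le_one.trans h.one_le
  have hnn : ∀ τ : T, 0 ≤ derivNorm X φ τ := derivNorm_nonneg
  have hloc : ∀ τ : T, ∀ x ∈ X, ∀ y ∈ Metric.ball x δ,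
      dist (Phi φ τ x) (Phi φ τ y) ≤ K * δ * derivNorm X φ τ := by
    intro τ x hx y hy
    refine (h.dist_Phi_le_of_mem_ball hT hne τ (hball x hx) (Metric.mem_ball_self hδ) hy).trans ?_
    rw [mul_right_comm]
    have := hnn τ
    gcongr
    exact (Metric.mem_ball'.mp hy).le
  -- The mean value inequality applies only on balls inside `V`, and `X` need not be convex.
  -- Connectedness joins any two points through such balls, with a constant independent of `τ`.
  -- Compactness then makes it uniform in the points.
  let P : EuclideanSpace ℝ (Fin d) → EuclideanSpace ℝ (Fin d) → Prop := fun x y =>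
    ∃ C : ℝ, ∀ τ : T, dist (Phi φ τ x) (Phi φ τ y) ≤ C * derivNorm X φ τ
  have hP : ∀ x ∈ X, ∀ y ∈ X, P x y := by
    intro x hx y hy
    refine hX.isConnected.isPreconnected.induction₂' P (fun x hx => ?_) ?_ hx hy
    · filter_upwards [mem_nhdsWithin_of_mem_nhds (Metric.ball_mem_nhds x hδ)] with y hy
      refine ⟨⟨K * δ, fun τ => hloc τ x hx y hy⟩, ⟨K * δ, fun τ => ?_⟩⟩
      rw [dist_comm]
      exact hloc τ x hx y hy
    · rintro x y z - - - ⟨C₁, h₁⟩ ⟨C₂, h₂⟩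
      refine ⟨C₁ + C₂, fun τ => (dist_triangle _ (Phi φ τ y) _).trans ?_⟩
      rw [add_mul]
      exact add_le_add (h₁ τ) (h₂ τ)
  obtain ⟨x₀, hx₀⟩ := hne
  choose! C hC using hP x₀ hx₀
  obtain ⟨t, htX, ht⟩ := hX.isCompact.elim_nhds_subcover (fun x => Metric.ball x δ)
    fun x _ => Metric.ball_mem_nhds x hδ
  obtain ⟨B, hB⟩ := (t.finite_toSet.image C).bddAbove
  have hB' : ∀ x ∈ X, ∀ τ : T,
      dist (Phi φ τ x₀) (Phi φ τ x) ≤ (max B 1 + K * δ) * derivNorm X φ τ := by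
    intro x hx τ
    obtain ⟨y, hy, hxy⟩ := Set.mem_iUnion₂.mp (ht hx)
    have h1 : C y ≤ max B 1 := (hB ⟨y, hy, rfl⟩).trans (le_max_left _ _)
    refine (dist_triangle _ (Phi φ τ y) _).trans ?_
    rw [add_mul]
    refine add_le_add ((hC y (htX y hy) τ).trans ?_) (hloc τ y (htX y hy) x hxy)
    have := hnn τ
    gcongr
  refine ⟨2 * (max B 1 + K * δ), by positivity, fun τ x hx y hy => ?_⟩
  have h1 := dist_triangle_left (Phi φ τ x) (Phi φ τ y) (Phi φ τ x₀)
  have h2 := hB' x hx τ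
  have h3 := hB' y hy τ
  linarith

/-- The contraction is known only on `X`, so it controls the derivative at an interior point.
Bounded distortion carries the bound to the rest of `X`. -/
theorem derivNorm_le_pow (h : IsConformalDomain X φ V K) (hT : IsRootedTree T) (hX : IsTIFS X φ)
    (hint : (interior X).Nonempty) {s : ℝ} (hs0 : 0 < s)
    (hs : ∀ τ : T, τ ≠ ⊥ → ∀ x ∈ X, ∀ y ∈ X, dist (φ τ x) (φ τ y) ≤ s * dist x y) (τ : T) :
    derivNorm X φ τ ≤ K * s ^ height τ := by
  obtain ⟨x, hx⟩ := hint
  have hxX := interior_subset hx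
  refine (h.derivNorm_le hX.isConnected.nonempty τ (h.subset hxX)).trans ?_
  have := h.one_le
  gcongr
  refine norm_fderiv_le_of_lip' ℝ (by positivity) ?_
  filter_upwards [mem_interior_iff_mem_nhds.mp hx] with y hy
  rw [← dist_eq_norm, ← dist_eq_norm]
  exact dist_Phi_le hX hT hs0 hs τ y hy x hxX

end IsConformalDomain

theorem exists_mem_frontier_of_isPreconnected {α : Type*} [TopologicalSpace α] {s t : Set α}
    (ht : IsPreconnected t) (h₁ : (t ∩ s).Nonempty) (h₂ : (t ∩ sᶜ).Nonempty) :
    ∃ x ∈ t, x ∈ frontier s := by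
  by_contra! h
  obtain ⟨x, hx, hxs⟩ := h₁
  obtain ⟨y, hy, hys⟩ := h₂
  have hmem : ∀ z ∈ t, z ∈ closure s → z ∈ interior s := fun z hz hzs =>
    not_not.mp fun hzi => h z hz ⟨hzs, hzi⟩
  obtain ⟨z, -, hz₁, hz₂⟩ := ht (interior s) (closure s)ᶜ isOpen_interior
    isClosed_closure.isOpen_compl
    (fun z hz => (em (z ∈ closure s)).imp (hmem z hz) id)
    ⟨x, hx, hmem x hx (subset_closure hxs)⟩
    ⟨y, hy, fun hyc => hys (interior_subset (hmem y hy hyc))⟩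
  exact hz₂ (subset_closure (interior_subset hz₁))

/-- The cone condition provides interior balls of comparable size near every point. -/
theorem IsConformalTIFS.exists_ball_subset_interior (hX : IsConformalTIFS X φ) :
    ∃ c l : ℝ, 0 < c ∧ c ≤ 1 ∧ 0 < l ∧ ∀ z ∈ X, ∀ ρ, 0 < ρ → ρ ≤ l →
      ∃ w, dist w z ≤ ρ ∧ Metric.ball w (c * ρ) ⊆ interior X := by
  obtain ⟨α, l, hα0, hαπ, hl, hcone⟩ := hX.cone_condition
  have hcos : Real.cos α < 1 := by
    rw [← Real.cos_zero]
    exact Real.cos_lt_cos_of_nonneg_of_le_pi le_rfl hαπ.le hα0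
  obtain ⟨c, hc0, hc⟩ := exists_between (show (0 : ℝ) < min 1 ((1 - Real.cos α) / 2) by
    refine lt_min one_pos ?_
    linarith)
  have hc1 : c < 1 := hc.trans_le (min_le_left _ _)
  have hc2 : c < (1 - Real.cos α) / 2 := hc.trans_le (min_le_right _ _)
  refine ⟨c / 2, l, by positivity, by linarith, hl, fun z hz ρ hρ hρl => ?_⟩
  -- Either `z` itself serves as centre, or a frontier point lies within `ρ / 2` of `z`. In the
  -- second case the centre is taken at distance `ρ / 2` along the axis of its cone.
  by_cases hsub : Metric.ball z (ρ / 2) ⊆ interior X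
  · refine ⟨z, by simpa using hρ.le, (Metric.ball_subset_ball ?_).trans hsub⟩
    nlinarith
  · obtain ⟨p, hp, hpX⟩ := Set.not_subset.mp hsub
    obtain ⟨x, hx, hxX⟩ : ∃ x ∈ Metric.ball z (ρ / 2), x ∈ frontier X := by
      by_cases hpX' : p ∈ X
      · exact ⟨p, hp, subset_closure hpX', hpX⟩
      · exact exists_mem_frontier_of_isPreconnected (convex_ball z (ρ / 2)).isPreconnected
          ⟨z, Metric.mem_ball_self (by positivity), hz⟩ ⟨p, hp, hpX'⟩
    obtain ⟨v, hv, hvX⟩ := hcone x hxX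
    refine ⟨x + (ρ / 2) • v, ?_, ?_⟩
    · refine (dist_triangle _ x _).trans ?_
      have h1 : dist (x + (ρ / 2) • v) x = ρ / 2 := by
        rw [dist_eq_norm, add_sub_cancel_left, norm_smul, hv, mul_one,
          Real.norm_of_nonneg (by positivity)]
      have h2 := Metric.mem_ball.mp hx
      linarith
    · rw [show c / 2 * ρ = c * (ρ / 2) by ring]
      exact (ball_subset_openCone hv hc0 hc1 (by linarith) (by positivity) (by linarith)).trans hvX

theorem IsConformalTIFS.interior_nonempty (hX : IsConformalTIFS X φ) : (interior X).Nonempty := by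
  obtain ⟨c, l, hc, -, hl, h⟩ := hX.exists_ball_subset_interior
  obtain ⟨z, hz⟩ := hX.isConnected.nonempty
  obtain ⟨w, -, hw⟩ := h z hz l hl le_rfl
  exact ⟨w, hw (Metric.mem_ball_self (by positivity))⟩

/-- The number of vertices `p` of a given height with `‖Φ_p'‖ ≥ r` such that `Φ_p(X)` comes
within distance `r` of a given point is bounded by a constant. -/
theorem IsConformalTIFS.exists_card_le (hX : IsConformalTIFS X φ) (hT : IsRootedTree T)
    (hd : 0 < d) :
    ∃ M : ℝ, 0 < M ∧ ∀ (n : ℕ) (r : ℝ) (x : EuclideanSpace ℝ (Fin d)) (F : Finset T), 0 < r →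
      (∀ p ∈ F, height p = n ∧ r ≤ derivNorm X φ p ∧ ∃ z ∈ X, dist (Phi φ p z) x ≤ r) →
      (F.card : ℝ) ≤ M := by
  have := nontrivial_euclideanSpace hd
  obtain ⟨V, K, h⟩ := hX.exists_isConformalDomain
  obtain ⟨δ, hδ, hball⟩ := h.exists_ball_subset hX.isCompact
  obtain ⟨c, l, hc, hc1, hl, hint⟩ := hX.exists_ball_subset_interior
  have hne := hX.isConnected.nonempty
  have hK : 0 < K := one_pos.trans_le h.one_le
  -- The scale `a` allows the cone condition to be used at radii up to `a` and keeps balls of radius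
  -- `2 a` about points of `X` inside `V`.
  obtain ⟨a, ha, hal, haδ⟩ : ∃ a : ℝ, 0 < a ∧ a ≤ l ∧ 2 * a < δ :=
    ⟨min l (δ / 4), by positivity, min_le_left _ _, by
      have := min_le_right l (δ / 4)
      linarith⟩
  set b : ℝ := 1 + 2 * K * a with hb
  have hb0 : 0 < b := by positivity
  refine ⟨(b * K / (c * a)) ^ d, by positivity, fun n r x F hr hF => ?_⟩
  have key : ∀ p ∈ F, ∃ S ⊆ interior X, IsOpen S ∧ Phi φ p '' S ⊆ Metric.closedBall x (b * r) ∧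
      ENNReal.ofReal ((c * a * r / K) ^ d) * volume (Metric.ball (0 : EuclideanSpace ℝ (Fin d)) 1)
        ≤ volume (Phi φ p '' S) := by
    intro p hp
    obtain ⟨-, hrp, z, hz, hzx⟩ := hF p hp
    have hD : 0 < derivNorm X φ p := hr.trans_le hrp
    -- With this radius, `Φ_p` turns length `ρ` into length of order `a r` whatever the size of
    -- `‖Φ_p'‖`. All images then have volume at least a constant times `r^d` and lie in one ball of
    -- radius `b r`.
    set ρ := a * (r / derivNorm X φ p) with hρ
    have hρ0 : 0 < ρ := by positivity
    have hρa : ρ ≤ a := mul_le_of_le_one_right ha.le ((div_le_one hD).mpr hrp)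
    have hDρ : derivNorm X φ p * ρ = a * r := by rw [hρ]; field_simp
    obtain ⟨w, hwz, hw⟩ := hint z hz ρ hρ0 (hρa.trans hal)
    have hcρ : c * ρ ≤ ρ := mul_le_of_le_one_left hρ0.le hc1
    refine ⟨Metric.ball w (c * ρ), hw, Metric.isOpen_ball, ?_, ?_⟩
    · rintro _ ⟨u, hu, rfl⟩
      have huz : dist u z ≤ 2 * ρ := by
        have h1 := dist_triangle u w z
        have h2 := Metric.mem_ball.mp hu
        linarith
      have h1 := h.dist_Phi_le_of_mem_ball hT hne p (hball z hz)
        (x := u) (y := z) (Metric.mem_ball.mpr (by linarith)) (Metric.mem_ball_self hδ)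
      have h2 : K * derivNorm X φ p * dist u z ≤ K * derivNorm X φ p * (2 * ρ) := by gcongr
      have h3 : K * derivNorm X φ p * (2 * ρ) = 2 * K * a * r := by
        linear_combination 2 * K * hDρ
      rw [Metric.mem_closedBall]
      have h4 := dist_triangle (Phi φ p u) (Phi φ p z) x
      rw [hb]
      linarith
    · refine le_trans (le_of_eq ?_) (h.le_volume_image hT hne p Metric.isOpen_ball.measurableSet
        (hw.trans (interior_subset.trans h.subset)))
      have hpow : (c * a * r / K) ^ d = (derivNorm X φ p / K) ^ d * (c * ρ) ^ d := by
        rw [← mul_pow, div_mul_eq_mul_div, show derivNorm X φ p * (c * ρ) = c * a * r by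
          linear_combination c * hDρ]
      rw [Measure.addHaar_ball volume w (by positivity), finrank_euclideanSpace_fin, hpow,
        ENNReal.ofReal_mul (by positivity), mul_assoc]
  choose! S hSX hSo hSb hSv using key
  have hdisj : (F : Set T).PairwiseDisjoint fun p => Phi φ p '' S p := fun p hp q hq hpq =>
    (h.disjoint_Phi_image_interior hT hX (hF p hp).1 (hF q hq).1 hpq).mono
      (Set.image_mono (hSX p hp)) (Set.image_mono (hSX q hq))
  have hmeas : ∀ p ∈ F, MeasurableSet (Phi φ p '' S p) := fun p hp =>
    (h.isOpen_Phi_image hT p _ (hSo p hp)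
      ((hSX p hp).trans (interior_subset.trans h.subset))).measurableSet
  have hsum : ∑ p ∈ F, ENNReal.ofReal ((c * a * r / K) ^ d) *
      volume (Metric.ball (0 : EuclideanSpace ℝ (Fin d)) 1)
      ≤ ENNReal.ofReal ((b * r) ^ d) * volume (Metric.ball (0 : EuclideanSpace ℝ (Fin d)) 1) :=
    calc _ ≤ ∑ p ∈ F, volume (Phi φ p '' S p) := Finset.sum_le_sum hSv
      _ = volume (⋃ p ∈ F, Phi φ p '' S p) := (measure_biUnion_finset hdisj hmeas).symm
      _ ≤ volume (Metric.closedBall x (b * r)) := measure_mono (Set.iUnion₂_subset hSb)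
      _ = _ := by
        rw [Measure.addHaar_closedBall _ _ (by positivity), finrank_euclideanSpace_fin]
  -- Both sides are multiples of the volume of the unit ball. Cancelling it leaves a bound on the
  -- cardinality in which the powers of `r` cancel as well.
  rw [← Finset.sum_mul, ENNReal.mul_le_mul_iff_left
    (Metric.measure_ball_pos _ _ one_pos).ne' measure_ball_lt_top.ne, Finset.sum_const,
    nsmul_eq_mul, ← ENNReal.ofReal_natCast, ← ENNReal.ofReal_mul (by positivity),
    ENNReal.ofReal_le_ofReal_iff (by positivity)] at hsum
  rw [show (b * K / (c * a)) ^ d = (b * r) ^ d / (c * a * r / K) ^ d by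
    rw [← div_pow]; congr 1; field_simp]
  rwa [le_div_iff₀ (by positivity)]

end Estimates
end TreeIFS

/-! ### The quantities `Z_n^*` and their limit. -/

namespace TreeIFS

section Zstar

variable {T : Type*} [PartialOrder T] [OrderBot T] {d : ℕ} {X : Set (EuclideanSpace ℝ (Fin d))}
  {φ : T → EuclideanSpace ℝ (Fin d) → EuclideanSpace ℝ (Fin d)}

omit [OrderBot T] in
theorem sum_derivNorm_rpow_nonneg (t : ℝ) (A : Finset T) :
    0 ≤ ∑ ω ∈ A, derivNorm X φ ω ^ t :=
  Finset.sum_nonneg fun ω _ => Real.rpow_nonneg (IsConformalDomain.derivNorm_nonneg ω) t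

theorem Zstar_nonneg (t : ℝ) (n : ℕ) : 0 ≤ Zstar X φ t n := by
  refine Real.sInf_nonneg ?_
  rintro _ ⟨A, -, rfl⟩
  exact sum_derivNorm_rpow_nonneg t A

theorem Zstar_le_sum {t : ℝ} {n : ℕ} {A : Finset T}
    (hA : IsMaximalAntichainIn (belowLevel T n) (A : Set T)) :
    Zstar X φ t n ≤ ∑ ω ∈ A, derivNorm X φ ω ^ t :=
  csInf_le ⟨0, by rintro _ ⟨A, -, rfl⟩; exact sum_derivNorm_rpow_nonneg t A⟩ ⟨A, hA, rfl⟩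

theorem exists_sum_lt_of_Zstar_lt (hT : IsRootedTree T) (hT' : IsPrunedFinitelySplitting T)
    {t ε : ℝ} {n : ℕ} (hn : 1 ≤ n) (h : Zstar X φ t n < ε) :
    ∃ A : Finset T, IsMaximalAntichainIn (belowLevel T n) (A : Set T) ∧
      ∑ ω ∈ A, derivNorm X φ ω ^ t < ε := by
  obtain ⟨A, hA⟩ := exists_isMaximalAntichainIn_belowLevel hT hT' hn
  obtain ⟨_, ⟨B, hB, rfl⟩, hlt⟩ := exists_lt_of_csInf_lt (by exact ⟨_, A, hA, rfl⟩) h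
  exact ⟨B, hB, hlt⟩

theorem Zstar_antitone (hT : IsRootedTree T) (hT' : IsPrunedFinitelySplitting T) (t : ℝ)
    {n m : ℕ} (hn : 1 ≤ n) (hnm : n ≤ m) : Zstar X φ t m ≤ Zstar X φ t n := by
  refine le_of_forall_gt fun ε hε => ?_
  obtain ⟨A, hA, hlt⟩ := exists_sum_lt_of_Zstar_lt hT hT' hn hε
  exact (Zstar_le_sum (hA.belowLevel_mono hT hn hnm)).trans_lt hlt

theorem tendsto_Zstar (hT : IsRootedTree T) (hT' : IsPrunedFinitelySplitting T) (t : ℝ) :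
    Tendsto (Zstar X φ t) atTop (𝓝 (ZstarInf X φ t)) := by
  -- The shift skips `n = 0`: `belowLevel T 0` is empty, so `Zstar` vanishes there and is not
  -- antitone from the start.
  have hanti : Antitone fun n => Zstar X φ t (n + 1) := fun n m h =>
    Zstar_antitone hT hT' t (by omega) (by omega)
  have h := tendsto_atTop_ciInf hanti ⟨0, by rintro _ ⟨n, rfl⟩; exact Zstar_nonneg t _⟩
  exact tendsto_nhds_limUnder ⟨_, (tendsto_add_atTop_iff_nat 1).mp h⟩

theorem ZstarInf_nonneg (hT : IsRootedTree T) (hT' : IsPrunedFinitelySplitting T) (t : ℝ) :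
    0 ≤ ZstarInf X φ t :=
  ge_of_tendsto' (tendsto_Zstar hT hT' t) fun n => Zstar_nonneg t n

theorem ZstarInf_le_Zstar (hT : IsRootedTree T) (hT' : IsPrunedFinitelySplitting T) (t : ℝ)
    {n : ℕ} (hn : 1 ≤ n) : ZstarInf X φ t ≤ Zstar X φ t n :=
  le_of_tendsto (tendsto_Zstar hT hT' t)
    ((eventually_ge_atTop n).mono fun _ hm => Zstar_antitone hT hT' t hn hm)

theorem exists_sum_lt_of_ZstarInf_eq_zero (hT : IsRootedTree T)
    (hT' : IsPrunedFinitelySplitting T) {t ε : ℝ} (h : ZstarInf X φ t = 0) (hε : 0 < ε) :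
    ∃ n, 1 ≤ n ∧ ∃ A : Finset T, IsMaximalAntichainIn (belowLevel T n) (A : Set T) ∧
      ∑ ω ∈ A, derivNorm X φ ω ^ t < ε := by
  obtain ⟨n, hn, hlt⟩ := ((eventually_ge_atTop 1).and
    ((tendsto_Zstar (X := X) (φ := φ) hT hT' t).eventually (gt_mem_nhds (h ▸ hε)))).exists
  exact ⟨n, hn, exists_sum_lt_of_Zstar_lt hT hT' hn hlt⟩

/-- For `t = 0` the sum counts the antichain, and a maximal antichain is nonempty because level one
is. -/
theorem ZstarInf_zero_ne_zero (hT : IsRootedTree T) (hT' : IsPrunedFinitelySplitting T) :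
    ZstarInf X φ 0 ≠ 0 := by
  intro h
  obtain ⟨n, hn, A, hA, hlt⟩ := exists_sum_lt_of_ZstarInf_eq_zero hT hT' h one_pos
  obtain ⟨c, hc⟩ := (hT' ⊥).1
  obtain ⟨a, ha, -⟩ := hA.exists_comparable (τ := c)
    ⟨hc.1, by rw [hc.2, height_bot]; exact hn⟩
  have hcard : 0 < A.card := Finset.card_pos.mpr ⟨a, ha⟩
  simp only [Real.rpow_zero, Finset.sum_const, nsmul_eq_mul, mul_one] at hlt
  have : A.card < 1 := by exact_mod_cast hlt
  omega

/-! ### The upper bound for the dimension. -/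

/-- The pieces of a maximal antichain cover the limit set. -/
theorem limitSet_subset_iUnion (hT : IsRootedTree T) {n : ℕ} (hn : 1 ≤ n) {A : Finset T}
    (hA : IsMaximalAntichainIn (belowLevel T n) (A : Set T)) :
    limitSet X φ ⊆ ⋃ a : A, Phi φ a '' X := by
  rintro x ⟨ω, hω, hx⟩
  have hx' : ∀ k, 1 ≤ k → x ∈ Phi φ (ω k) '' X :=
    Set.mem_iInter₂.mp (hx ▸ Set.mem_singleton x)
  have hωn := height_of_mem_boundary hω n
  obtain ⟨a, ha, hcomp⟩ := hA.exists_comparable (τ := ω n)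
    ⟨hT.bot_lt_of_height_pos (by omega), hωn.le⟩
  have haP := hA.prop.1 ha
  have han : a ≤ ω n := by
    rcases hcomp with h | h
    · exact h
    · rcases h.eq_or_lt with h' | h'
      · exact h'.ge
      · have := hT.height_lt h'
        have := haP.2
        omega
  refine Set.mem_iUnion.mpr ⟨⟨a, ha⟩, ?_⟩
  have h1 := hx' _ (hT.height_pos haP.1)
  rwa [← eq_of_le_of_mem_boundary hT hω han] at h1

open MeasureTheory in
theorem dimH_limitSet_le (hT : IsRootedTree T) (hT' : IsPrunedFinitelySplitting T)
    (hX : IsConformalTIFS X φ) {t : ℝ} (ht : 0 ≤ t) (h : ZstarInf X φ t = 0) :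
    dimH (limitSet X φ) ≤ ENNReal.ofReal t := by
  rcases ht.eq_or_lt with rfl | ht0
  · exact absurd h (ZstarInf_zero_ne_zero hT hT')
  obtain ⟨V, K, hV⟩ := hX.exists_isConformalDomain
  obtain ⟨C, hC, hdist⟩ := hV.exists_dist_Phi_le hT hX.toIsTIFS
  have hnn : ∀ τ : T, 0 ≤ derivNorm X φ τ := IsConformalDomain.derivNorm_nonneg
  let ε : ℕ → ℝ := fun k => 1 / ((k : ℝ) + 1)
  have hε : ∀ k, 0 < ε k := fun k => by positivity
  have hεlim : Tendsto ε atTop (𝓝 0) := tendsto_one_div_add_atTop_nhds_zero_nat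
  choose n hn A hA hlt using fun k => exists_sum_lt_of_ZstarInf_eq_zero hT hT' h (hε k)
  have hdiam : ∀ τ : T, Metric.ediam (Phi φ τ '' X) ≤ ENNReal.ofReal (C * derivNorm X φ τ) := by
    intro τ
    refine Metric.ediam_le ?_
    rintro _ ⟨x, hx, rfl⟩ _ ⟨y, hy, rfl⟩
    rw [edist_dist]
    exact ENNReal.ofReal_le_ofReal (hdist τ x hx y hy)
  -- Each term is at most the whole sum, so small sums force small diameters. This needs `t > 0`.
  have hsmall : ∀ k, ∀ a ∈ A k, derivNorm X φ a ≤ ε k ^ t⁻¹ := fun k a ha => by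
    have h1 : derivNorm X φ a ^ t ≤ ε k :=
      (Finset.single_le_sum (f := fun a => derivNorm X φ a ^ t)
        (fun b _ => Real.rpow_nonneg (hnn b) t) ha).trans (hlt k).le
    have h2 := Real.rpow_le_rpow (Real.rpow_nonneg (hnn a) t) h1 (inv_nonneg.mpr ht)
    rwa [Real.rpow_rpow_inv (hnn a) ht0.ne'] at h2
  have hμ : Measure.hausdorffMeasure t (limitSet X φ) ≤ 0 := by
    refine (Measure.hausdorffMeasure_le_liminf_sum t (limitSet X φ) (l := atTop)
      (fun k => ENNReal.ofReal (C * ε k ^ t⁻¹)) ?_ (fun k (a : A k) => Phi φ (a : T) '' X)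
      (Eventually.of_forall fun k a => ?_)
      (Eventually.of_forall fun k => limitSet_subset_iUnion hT (hn k) (hA k))).trans ?_
    · have h1 : Tendsto (fun k => C * ε k ^ t⁻¹) atTop (𝓝 (C * 0 ^ t⁻¹)) :=
        (hεlim.rpow_const (Or.inr (inv_nonneg.mpr ht))).const_mul C
      rw [Real.zero_rpow (inv_ne_zero ht0.ne'), mul_zero] at h1
      simpa using ENNReal.tendsto_ofReal h1
    · refine (hdiam a).trans (ENNReal.ofReal_le_ofReal ?_)
      have := hsmall k a a.2
      gcongr
    · have hbound : ∀ k, ∑ a : A k, Metric.ediam (Phi φ (a : T) '' X) ^ t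
          ≤ ENNReal.ofReal (C ^ t * ε k) := fun k => by
        calc ∑ a : A k, Metric.ediam (Phi φ (a : T) '' X) ^ t
            ≤ ∑ a : A k, ENNReal.ofReal (C ^ t * derivNorm X φ a ^ t) := by
              refine Finset.sum_le_sum fun a _ => ?_
              rw [← Real.mul_rpow hC.le (hnn _),
                ← ENNReal.ofReal_rpow_of_nonneg (mul_nonneg hC.le (hnn _)) ht]
              exact ENNReal.rpow_le_rpow (hdiam a) ht
          _ = ENNReal.ofReal (C ^ t * ∑ a ∈ A k, derivNorm X φ a ^ t) := by
              rw [Finset.mul_sum, ENNReal.ofReal_sum_of_nonneg fun a _ =>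
                mul_nonneg (Real.rpow_nonneg hC.le t) (Real.rpow_nonneg (hnn a) t)]
              exact Finset.sum_coe_sort (A k) fun a =>
                ENNReal.ofReal (C ^ t * derivNorm X φ a ^ t)
          _ ≤ _ := by
              refine ENNReal.ofReal_le_ofReal ?_
              have := (hlt k).le
              gcongr
      have hlim : Tendsto (fun k => ENNReal.ofReal (C ^ t * ε k)) atTop (𝓝 0) := by
        simpa using ENNReal.tendsto_ofReal (hεlim.const_mul (C ^ t))
      exact (liminf_le_liminf (Eventually.of_forall hbound)).trans hlim.liminf_eq.le
  refine dimH_le_of_hausdorffMeasure_ne_top (d := t.toNNReal) ?_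
  rw [Real.coe_toNNReal t ht, nonpos_iff_eq_zero.mp hμ]
  exact ENNReal.zero_ne_top

/-! ### The lower bound for the dimension. -/

/-- The vertices `c` with `‖Φ_c'‖ ≤ r ≤ ‖Φ_p'‖`, where `p` is the predecessor of `c` and `Φ_p(X)`
comes within distance `r` of a given point, contribute at most a constant times `r ^ s` to
the sum of the `‖Φ_c'‖ ^ t` when `s < t`. -/
theorem IsConformalTIFS.exists_sum_le (hT : IsRootedTree T) (hT' : IsPrunedFinitelySplitting T)
    (hX : IsConformalTIFS X φ) (hd : 0 < d) (hsub : SubexponentialSplitting T) {s t : ℝ}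
    (hs : 0 ≤ s) (hst : s < t) :
    ∃ C : ℝ, 0 < C ∧ ∀ (r : ℝ) (x : EuclideanSpace ℝ (Fin d)) (F : Finset T), 0 < r →
      (∀ c ∈ F, ∃ p, c ∈ successors p ∧ derivNorm X φ c ≤ r ∧ r ≤ derivNorm X φ p ∧
        ∃ z ∈ X, dist (Phi φ p z) x ≤ r) →
      ∑ c ∈ F, derivNorm X φ c ^ t ≤ C * r ^ s := by
  classical
  obtain ⟨V, K, hV⟩ := hX.exists_isConformalDomain
  have hK : 0 < K := one_pos.trans_le hV.one_le
  obtain ⟨σ, hσ0, hσ1, hσ⟩ := hX.contracting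
  have hpow := hV.derivNorm_le_pow hT hX.toIsTIFS hX.interior_nonempty hσ0 hσ
  obtain ⟨M, hM, hcard⟩ := hX.exists_card_le hT hd
  have hnn : ∀ τ : T, 0 ≤ derivNorm X φ τ := IsConformalDomain.derivNorm_nonneg
  have hts : 0 < t - s := sub_pos.mpr hst
  have hlog : Real.log σ < 0 := Real.log_neg hσ0 hσ1
  -- Half of the exponential gain from `σ ^ (t - s)` is given to the branching, so that `q = σ ^ ((t
  -- - s) / 2) < 1`.
  set η : ℝ := -(Real.log σ * (t - s)) / 2 with hη
  have hη0 : 0 < η := by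
    have := mul_neg_of_neg_of_pos hlog hts
    rw [hη]
    linarith
  obtain ⟨B, hB, hsucc⟩ := hsub.exists_bound hT hT' hη0
  set q : ℝ := Real.exp η * σ ^ (t - s) with hq
  have hq0 : 0 < q := by positivity
  have hq1 : q < 1 := by
    rw [hq, Real.rpow_def_of_pos hσ0, ← Real.exp_add, Real.exp_lt_one_iff, hη]
    have := mul_neg_of_neg_of_pos hlog hts
    linarith
  set D : ℝ := M * B * K ^ (t - s) with hD
  have hD0 : 0 < D := by positivity
  refine ⟨D * (1 - q)⁻¹, mul_pos hD0 (inv_pos.mpr (by linarith)), fun r x F hr hF => ?_⟩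
  choose! p hp hcr hrp hz using hF
  -- The count is made one height at a time, since disjointness holds only between pieces of equal
  -- height.
  have hlevel : ∀ n, ∑ c ∈ F with height (p c) = n, derivNorm X φ c ^ t ≤ D * r ^ s * q ^ n := by
    intro n
    set Fn := F.filter fun c => height (p c) = n with hFn
    have hmem : ∀ c ∈ Fn, c ∈ F ∧ height (p c) = n := fun c hc => Finset.mem_filter.mp hc
    rcases Fn.eq_empty_or_nonempty with hemp | ⟨c₀, hc₀⟩
    · rw [hemp, Finset.sum_empty]
      positivity
    have hcardG : ((Fn.image p).card : ℝ) ≤ M := by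
      refine hcard n r x _ hr fun a ha => ?_
      obtain ⟨c, hc, rfl⟩ := Finset.mem_image.mp ha
      exact ⟨(hmem c hc).2, hrp c (hmem c hc).1, hz c (hmem c hc).1⟩
    have hcardF : (Fn.card : ℝ) ≤ M * (B * Real.exp η ^ n) := by
      have h1 : Fn.card ≤ ∑ a ∈ Fn.image p, (successors a).ncard := by
        rw [Finset.card_eq_sum_card_fiberwise (f := p) (t := Fn.image p)
          fun c hc => Finset.mem_image_of_mem p hc]
        refine Finset.sum_le_sum fun a _ => ?_
        rw [← Set.ncard_coe_finset]
        refine Set.ncard_le_ncard (fun c hc => ?_) (hT' a).2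
        obtain ⟨hcF, rfl⟩ := Finset.mem_filter.mp (Finset.mem_coe.mp hc)
        exact hp c (hmem c hcF).1
      calc (Fn.card : ℝ) ≤ ∑ a ∈ Fn.image p, ((successors a).ncard : ℝ) := by exact_mod_cast h1
        _ ≤ ∑ _a ∈ Fn.image p, B * Real.exp η ^ n := by
          refine Finset.sum_le_sum fun a ha => ?_
          obtain ⟨c, hc, rfl⟩ := Finset.mem_image.mp ha
          have h2 := hsucc (p c)
          rwa [(hmem c hc).2] at h2
        _ = (Fn.image p).card * (B * Real.exp η ^ n) := by rw [Finset.sum_const, nsmul_eq_mul]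
        _ ≤ _ := by gcongr
    have hrK : r ≤ K * σ ^ n := by
      have h1 := (hrp c₀ (hmem c₀ hc₀).1).trans (hpow (p c₀))
      rwa [(hmem c₀ hc₀).2] at h1
    have hrt : r ^ t ≤ r ^ s * (K ^ (t - s) * (σ ^ (t - s)) ^ n) := by
      have h1 : r ^ t = r ^ s * r ^ (t - s) := by
        rw [← Real.rpow_add hr]
        congr 1
        ring
      have h2 : (K * σ ^ n) ^ (t - s) = K ^ (t - s) * (σ ^ (t - s)) ^ n := by
        rw [Real.mul_rpow hK.le (by positivity), ← Real.rpow_natCast, ← Real.rpow_natCast,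
          ← Real.rpow_mul hσ0.le, ← Real.rpow_mul hσ0.le, mul_comm (n : ℝ)]
      rw [h1, ← h2]
      gcongr
    calc ∑ c ∈ Fn, derivNorm X φ c ^ t ≤ ∑ _c ∈ Fn, r ^ t :=
          Finset.sum_le_sum fun c hc =>
            Real.rpow_le_rpow (hnn c) (hcr c (hmem c hc).1) (hs.trans hst.le)
      _ = Fn.card * r ^ t := by rw [Finset.sum_const, nsmul_eq_mul]
      _ ≤ M * (B * Real.exp η ^ n) * (r ^ s * (K ^ (t - s) * (σ ^ (t - s)) ^ n)) := by gcongr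
      _ = D * r ^ s * q ^ n := by rw [hD, hq, mul_pow]; ring
  calc ∑ c ∈ F, derivNorm X φ c ^ t
      = ∑ n ∈ F.image fun c => height (p c), ∑ c ∈ F with height (p c) = n,
          derivNorm X φ c ^ t :=
        (Finset.sum_fiberwise_of_maps_to
          (fun c hc => Finset.mem_image_of_mem (fun c => height (p c)) hc) _).symm
    _ ≤ ∑ n ∈ F.image fun c => height (p c), D * r ^ s * q ^ n :=
        Finset.sum_le_sum fun n _ => hlevel n
    _ = D * r ^ s * ∑ n ∈ F.image fun c => height (p c), q ^ n := by rw [Finset.mul_sum]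
    _ ≤ D * r ^ s * (1 - q)⁻¹ := by
        gcongr
        rw [← tsum_geometric_of_lt_one hq0.le hq1]
        exact (summable_geometric_of_lt_one hq0.le hq1).sum_le_tsum _ fun n _ => by positivity
    _ = D * (1 - q)⁻¹ * r ^ s := by ring

/-- Used to replace a diameter, possibly zero, by a positive radius at little cost to the sum of
powers. -/
theorem exists_gt_rpow_lt {s δ e : ℝ} (hs : 0 < s) (hδ : δ < 1) (he : 0 < e) :
    ∃ r, δ < r ∧ r ≤ 1 ∧ r ^ s < δ ^ s + e := by
  have h1 : ∀ᶠ r in 𝓝 δ, r ^ s < δ ^ s + e :=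
    (Real.continuousAt_rpow_const δ s (Or.inr hs.le)).eventually_lt continuousAt_const
      (lt_add_of_pos_right _ he)
  have h2 : ∀ᶠ r in 𝓝[>] δ, r ∈ Set.Ioo δ 1 := Ioo_mem_nhdsGT hδ
  obtain ⟨r, hr, hr'⟩ := ((h1.filter_mono nhdsWithin_le_nhds).and h2).exists
  exact ⟨r, hr'.1, hr'.2.le, hr⟩

open MeasureTheory in
/-- A set of vanishing Hausdorff measure is covered by balls of radius at most `1` such that
the sum of the powers of the radii is arbitrarily small. -/
theorem exists_closedBall_cover {M : Type*} [MetricSpace M] [MeasurableSpace M] [BorelSpace M]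
    [Nonempty M] {s : ℝ} (hs : 0 < s) {J : Set M} (hJ : Measure.hausdorffMeasure s J = 0) {ε : ℝ}
    (hε : 0 < ε) :
    ∃ (x : ℕ → M) (r : ℕ → ℝ), (∀ i, 0 < r i ∧ r i ≤ 1) ∧ (∀ y ∈ J, ∃ i, dist y (x i) ≤ r i) ∧
      ∑' i, ENNReal.ofReal (r i ^ s) ≤ ENNReal.ofReal ε := by
  have hε2 : ENNReal.ofReal (ε / 2) ≠ 0 := by simpa using hε
  obtain ⟨e, he0, hesum⟩ := ENNReal.exists_pos_sum_of_countable hε2 ℕ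
  -- The mesh `2⁻¹` leaves room to enlarge each diameter to a radius at most `1`.
  have h1 : (⨅ (t : ℕ → Set M) (_ : J ⊆ ⋃ n, t n) (_ : ∀ n, Metric.ediam (t n) ≤ 2⁻¹),
      ∑' n, ⨆ _ : (t n).Nonempty, Metric.ediam (t n) ^ s) < ENNReal.ofReal (ε / 2) := by
    refine lt_of_le_of_lt ?_ (pos_iff_ne_zero.mpr hε2)
    rw [← hJ, Measure.hausdorffMeasure_apply]
    exact le_iSup₂ (f := fun (r : ENNReal) (_ : 0 < r) =>
      ⨅ (t : ℕ → Set M) (_ : J ⊆ ⋃ n, t n) (_ : ∀ n, Metric.ediam (t n) ≤ r),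
        ∑' n, ⨆ _ : (t n).Nonempty, Metric.ediam (t n) ^ s) 2⁻¹ (by simp)
  simp only [iInf_lt_iff] at h1
  obtain ⟨t, hJt, htd, hsum⟩ := h1
  have hfin : ∀ i, Metric.ediam (t i) ≠ ⊤ := fun i => ((htd i).trans_lt (by simp)).ne
  have hdiam : ∀ i, Metric.diam (t i) < 1 := fun i => by
    have h2 := ENNReal.toReal_mono (by simp) (htd i)
    rw [ENNReal.toReal_inv] at h2
    refine lt_of_le_of_lt h2 ?_
    norm_num
  choose r hr hr1 hre using fun i => exists_gt_rpow_lt hs (hdiam i) (he0 i)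
  have hx : ∀ i, ∃ x, ∀ y ∈ t i, dist y x ≤ r i := fun i => by
    rcases (t i).eq_empty_or_nonempty with h | ⟨x, hx⟩
    · exact ⟨Classical.arbitrary M, by simp [h]⟩
    · exact ⟨x, fun y hy =>
        (Metric.dist_le_diam_of_mem' (hfin i) hy hx).trans (hr i).le⟩
  choose x hx using hx
  refine ⟨x, r, fun i => ⟨Metric.diam_nonneg.trans_lt (hr i), hr1 i⟩, fun y hy => ?_, ?_⟩
  · obtain ⟨i, hi⟩ := Set.mem_iUnion.mp (hJt hy)
    exact ⟨i, hx i y hi⟩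
  · have hterm : ∀ i, ENNReal.ofReal (r i ^ s)
        ≤ (⨆ _ : (t i).Nonempty, Metric.ediam (t i) ^ s) + e i := fun i => by
      have h2 : ENNReal.ofReal (Metric.diam (t i) ^ s)
          ≤ ⨆ _ : (t i).Nonempty, Metric.ediam (t i) ^ s := by
        rcases (t i).eq_empty_or_nonempty with h | h
        · simp [h, Real.zero_rpow hs.ne']
        · rw [ciSup_pos h, ← ENNReal.ofReal_rpow_of_nonneg Metric.diam_nonneg hs.le, Metric.diam,
            ENNReal.ofReal_toReal (hfin i)]
      calc ENNReal.ofReal (r i ^ s) ≤ ENNReal.ofReal (Metric.diam (t i) ^ s + e i) :=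
            ENNReal.ofReal_le_ofReal (hre i).le
        _ ≤ ENNReal.ofReal (Metric.diam (t i) ^ s) + ENNReal.ofReal (e i) :=
            ENNReal.ofReal_add_le
        _ ≤ _ := by
            rw [ENNReal.ofReal_coe_nnreal]
            gcongr
    calc ∑' i, ENNReal.ofReal (r i ^ s)
        ≤ ∑' i, ((⨆ _ : (t i).Nonempty, Metric.ediam (t i) ^ s) + e i) :=
          ENNReal.tsum_le_tsum hterm
      _ = (∑' i, ⨆ _ : (t i).Nonempty, Metric.ediam (t i) ^ s) + ∑' i, (e i : ENNReal) :=
          ENNReal.tsum_add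
      _ ≤ ENNReal.ofReal (ε / 2) + ENNReal.ofReal (ε / 2) := add_le_add hsum.le hesum.le
      _ = ENNReal.ofReal ε := by
          rw [← ENNReal.ofReal_add (by positivity) (by positivity), add_halves]

open MeasureTheory in
theorem hausdorffMeasure_limitSet_ne_zero (hT : IsRootedTree T)
    (hT' : IsPrunedFinitelySplitting T) (hX : IsConformalTIFS X φ) (hd : 0 < d)
    (hsub : SubexponentialSplitting T) {s t : ℝ} (hs : 0 < s) (hst : s < t)
    (ht : 0 < ZstarInf X φ t) : Measure.hausdorffMeasure s (limitSet X φ) ≠ 0 := by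
  classical
  intro hμ
  have := nontrivial_euclideanSpace hd
  obtain ⟨V, K, hV⟩ := hX.exists_isConformalDomain
  obtain ⟨σ, hσ0, hσ1, hσ⟩ := hX.contracting
  have hpow := hV.derivNorm_le_pow hT hX.toIsTIFS hX.interior_nonempty hσ0 hσ
  obtain ⟨C, hC, hsum⟩ := hX.exists_sum_le hT hT' hd hsub hs.le hst
  obtain ⟨ε, hε, hεC⟩ : ∃ ε : ℝ, 0 < ε ∧ C * ε < ZstarInf X φ t :=
    ⟨ZstarInf X φ t / (2 * C), by positivity, by
      rw [mul_div_assoc', div_lt_iff₀ (by positivity)]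
      nlinarith [mul_pos hC ht]⟩
  obtain ⟨x, r, hr, hcov, hrsum⟩ := exists_closedBall_cover hs hμ hε
  let S : ℕ → Set T := fun i => {c | ∃ p, c ∈ successors p ∧ derivNorm X φ c ≤ r i ∧
    r i ≤ derivNorm X φ p ∧ ∃ z ∈ X, dist (Phi φ p z) (x i) ≤ r i}
  have hbot : ⊥ ∉ ⋃ i, S i := by
    intro h
    obtain ⟨i, p, hp, -⟩ := Set.mem_iUnion.mp h
    exact not_lt_bot hp.1
  have hcut : ∀ ω ∈ boundary T, ∃ n, ω n ∈ ⋃ i, S i := by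
    intro ω hω
    obtain ⟨y, hyJ, hy⟩ := hX.toIsTIFS.exists_mem_limitSet hT hω
    obtain ⟨i, hi⟩ := hcov y hyJ
    have hlim : Tendsto (fun n : ℕ => K * σ ^ n) atTop (𝓝 0) := by
      simpa using (tendsto_pow_atTop_nhds_zero_of_lt_one hσ0.le hσ1).const_mul K
    have hex : ∃ n, derivNorm X φ (ω n) < r i := by
      obtain ⟨n, hn⟩ := (hlim.eventually (gt_mem_nhds (hr i).1)).exists
      refine ⟨n, (hpow (ω n)).trans_lt ?_⟩
      rwa [height_of_mem_boundary hω]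
    -- The first vertex of the path with norm below `r i`. It is not the root, since `‖Φ_⊥'‖ = 1 ≥ r
    -- i`, so its predecessor still has norm at least `r i`.
    have hfind := Nat.find_spec hex
    obtain ⟨m, hm⟩ : ∃ m, Nat.find hex = m + 1 := by
      refine Nat.exists_eq_succ_of_ne_zero fun h0 => ?_
      rw [h0, hω.1, IsConformalDomain.derivNorm_bot hX.isConnected.nonempty] at hfind
      exact absurd (hr i).2 (not_le.mpr hfind)
    have hmin := not_lt.mp (Nat.find_min hex (m := m) (by omega))
    rw [hm] at hfind
    obtain ⟨z, hz, rfl⟩ := hy m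
    exact ⟨m + 1, Set.mem_iUnion.mpr ⟨i, ω m, hω.2 m, hfind.le, hmin, z, hz, hi⟩⟩
  obtain ⟨n, hn⟩ := exists_height_forall_exists_le hT hT' hcut
  have hn1 : 1 ≤ n := by
    by_contra h0
    obtain ⟨c, hc, hcle⟩ := hn ⊥ (by rw [height_bot]; omega)
    exact hbot (le_bot_iff.mp hcle ▸ hc)
  obtain ⟨A, hAS, hA⟩ := exists_isMaximalAntichainIn_subset hT hT' hbot hn
  have hidx : ∀ c ∈ A, ∃ i, c ∈ S i := fun c hc => Set.mem_iUnion.mp (hAS hc)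
  -- Each vertex of the antichain is charged to a single ball, so no ball is counted twice in the
  -- sum of the `r i ^ s`.
  choose! ι hι using hidx
  have hAsum : ∑ c ∈ A, derivNorm X φ c ^ t ≤ C * ∑ i ∈ A.image ι, r i ^ s := by
    rw [← Finset.sum_fiberwise_of_maps_to (g := ι) (t := A.image ι)
      fun c hc => Finset.mem_image_of_mem ι hc, Finset.mul_sum]
    refine Finset.sum_le_sum fun i _ => hsum (r i) (x i) _ (hr i).1 fun c hc => ?_
    obtain ⟨hcA, rfl⟩ := Finset.mem_filter.mp hc
    exact hι c hcA
  have hrs : ∑ i ∈ A.image ι, r i ^ s ≤ ε := by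
    rw [← ENNReal.ofReal_le_ofReal_iff hε.le,
      ENNReal.ofReal_sum_of_nonneg fun i _ => Real.rpow_nonneg (hr i).1.le s]
    exact (ENNReal.sum_le_tsum _).trans hrsum
  have h1 := (ZstarInf_le_Zstar hT hT' t hn1).trans ((Zstar_le_sum hA).trans hAsum)
  have h2 := mul_le_mul_of_nonneg_left hrs hC.le
  linarith

/-- The case `d = 0`: all derivatives vanish, so `Z_∞^*(t)` cannot be positive for `t > 0`. -/
theorem Zstar_of_subsingleton [Subsingleton (EuclideanSpace ℝ (Fin d))] {t : ℝ} (ht : 0 < t)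
    (n : ℕ) : Zstar X φ t n = 0 := by
  refine le_antisymm (Real.sInf_nonpos ?_) (Zstar_nonneg t n)
  rintro _ ⟨A, -, rfl⟩
  have h0 : ∀ ω : T, derivNorm X φ ω = 0 := fun ω => by
    have h1 : ∀ x : X, ‖fderiv ℝ (Phi φ ω) (x : EuclideanSpace ℝ (Fin d))‖ = 0 := fun x => by
      rw [norm_eq_zero]
      exact Subsingleton.elim _ _
    simp only [derivNorm, h1, Real.iSup_const_zero]
  simp [h0, Real.zero_rpow ht.ne']

theorem le_dimH_limitSet (hT : IsRootedTree T) (hT' : IsPrunedFinitelySplitting T)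
    (hX : IsConformalTIFS X φ) (hsub : SubexponentialSplitting T) {t : ℝ}
    (ht : 0 < ZstarInf X φ t) : ENNReal.ofReal t ≤ dimH (limitSet X φ) := by
  rcases le_or_gt t 0 with ht0 | ht0
  · simp [ENNReal.ofReal_of_nonpos ht0]
  rcases Nat.eq_zero_or_pos d with rfl | hd
  · refine absurd ht (not_lt.mpr (le_of_tendsto' (tendsto_Zstar hT hT' t) fun n => ?_))
    exact (Zstar_of_subsingleton ht0 n).le
  · refine le_of_forall_lt fun a ha => ?_
    obtain ⟨b, hab, hbt⟩ := ENNReal.lt_iff_exists_nnreal_btwn.mp ha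
    have hb0 : 0 < b := ENNReal.coe_pos.mp (bot_le.trans_lt hab)
    have hbt' : (b : ℝ) < t := by
      rwa [← ENNReal.ofReal_coe_nnreal, ENNReal.ofReal_lt_ofReal_iff ht0] at hbt
    exact hab.trans_le (le_dimH_of_hausdorffMeasure_ne_zero
      (hausdorffMeasure_limitSet_ne_zero hT hT' hX hd hsub (by exact_mod_cast hb0) hbt' ht))

theorem dimH_limitSet_eq_betaStar (hT : IsRootedTree T) (hT' : IsPrunedFinitelySplitting T)
    (hX : IsConformalTIFS X φ) (hsub : SubexponentialSplitting T) :
    dimH (limitSet X φ) = betaStar X φ := by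
  refine le_antisymm (le_sInf ?_) (le_of_forall_gt fun a ha => ?_)
  · rintro _ ⟨t, ht, h, rfl⟩
    exact dimH_limitSet_le hT hT' hX ht h
  -- For any finite `b` above the dimension, the lower bound forces `Z_∞^*(b) = 0`. Monotonicity in
  -- `t` is not needed.
  · obtain ⟨b, hab, hbt⟩ := ENNReal.lt_iff_exists_nnreal_btwn.mp ha
    refine lt_of_le_of_lt (sInf_le ⟨b, b.2, ?_, ENNReal.ofReal_coe_nnreal.symm⟩) hbt
    by_contra hne
    have h1 := le_dimH_limitSet hT hT' hX hsub
      ((ZstarInf_nonneg hT hT' (b : ℝ)).lt_of_ne' hne)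
    rw [ENNReal.ofReal_coe_nnreal] at h1
    exact absurd hab (not_lt.mpr h1)

end Zstar
end TreeIFS

/-- The first conjunct records that the limit defining `Z_∞^*(t)` exists. -/
theorem theorem2p12 {T : Type*} [PartialOrder T] [OrderBot T]
    (hT : TreeIFS.IsRootedTree T) (hT' : TreeIFS.IsPrunedFinitelySplitting T)
    {d : ℕ} (X : Set (EuclideanSpace ℝ (Fin d)))
    (φ : T → EuclideanSpace ℝ (Fin d) → EuclideanSpace ℝ (Fin d))
    (hΨ : TreeIFS.IsConformalTIFS X φ) :
    (∀ t : ℝ, 0 ≤ t →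
      Tendsto (TreeIFS.Zstar X φ t) atTop (𝓝 (TreeIFS.ZstarInf X φ t))) ∧
    (∀ t : ℝ, 0 ≤ t → TreeIFS.ZstarInf X φ t = 0 →
      dimH (TreeIFS.limitSet X φ) ≤ ENNReal.ofReal t) ∧
    (TreeIFS.SubexponentialSplitting T →
      (∀ t : ℝ, 0 ≤ t → 0 < TreeIFS.ZstarInf X φ t →
        ENNReal.ofReal t ≤ dimH (TreeIFS.limitSet X φ)) ∧
      dimH (TreeIFS.limitSet X φ) = TreeIFS.betaStar X φ) :=
  ⟨fun t _ => TreeIFS.tendsto_Zstar hT hT' t,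
    fun _ ht h => TreeIFS.dimH_limitSet_le hT hT' hΨ ht h,
    fun hsub => ⟨fun _ _ h => TreeIFS.le_dimH_limitSet hT hT' hΨ hsub h,
      TreeIFS.dimH_limitSet_eq_betaStar hT hT' hΨ hsub⟩⟩
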